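/- Let $A$ be a commutative $\mathbb{Q}$-algebra (of functions of $t=(t_1=x,t_2,t_3,\dots)$) with pairwise commuting derivations $\partial_k=\partial/\partial t_k$, $k\ge 1$, and put $\partial=\partial_1$. Consider formal pseudo-differential operators $P=\sum_{j\le N}P_jD^j$ with $P_j\in A$, multiplied by the rule $D^n f=\sum_{j\ge 0}\binom nj(\partial^jf)D^{n-j}$, $n\in\mathbb{Z}$; write $P_+=\sum_{j\ge0}P_jD^j$, $P_-=P-P_+$, and $P_+(f)=\sum_{j\ge 0}P_j\,\partial^jf$, $(P_+)^*(f)=\sum_{j\ge0}(-\partial)^j(P_jf)$ for $f\in A$. **Lax operators.** Let $r,m\ge1$. A Lax operator of $\mathsf{cKP}_{r,m}$ with eigenfunctions $\Phi_1,\dots,\Phi_m$ and adjoint eigenfunctions $\Psi_1,\dots,\Psi_m$ is an operator $$L=D^r+\sum_{j=0}^{r-2}u_jD^j+\sum_{i=1}^m\Phi_iD^{-1}\Psi_i$$ with $r$-th root $L^{1/r}=D+\sum_{i\ge0}v_iD^{-i-1}$ such that, for all $k\ge1$, $\partial_kL=[L^{k/r}_+,L]$, $\ \partial_k\Phi_i=L^{k/r}_+(\Phi_i)$,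 $\ \partial_k\Psi_i=-(L^{k/r}_+)^*(\Psi_i)$. For an eigenfunction $f$ (that is, $\partial_kf=L_+^{k/r}(f)$ for all $k\ge 1$) put $$L(f)=L_+(f)+\sum_{i=1}^m\Phi_i\,\partial^{-1}(\Psi_if),$$ where $\partial^{-1}(\Psi_if)$ is an $S\in A$ with $\partial_kS=(D^{-1}\Psi_iL^{k/r}_+)_+(f)$ for all $k\ge1$ (for $k=1$: $\partial S=\Psi_if$); any such $S$, which is unique up to an absolute constant, is allowed. **Tau-functions.** Define $p_n(-[\partial])$ by $\sum_{n\ge0}\lambda^np_n(-[\partial])=\exp\bigl(-\sum_{j\ge1}\tfrac{\lambda^j}{j}\partial_j\bigr)$. An invertible $\tau\in A$ is a tau-function of $L$ if $W=\sum_{n\ge0}\frac{p_n(-[\partial])\tau}{\tau}D^{-n}$ satisfies $L^{1/r}=WDW^{-1}$ and $\partial_kW=-L^{k/r}_-W$ for all $k\ge1$. **The orbit.** Let $L^{(0)}$ be a Lax operator of $\mathsf{cKP}_{r,m}$ with eigenfunctions $\Phi^{(0)}_i$ and adjoint eigenfunctions $\Psi_i^{(0)}$, and let $\chi^{(0)}_i=\Phi^{(0)}_i$,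 $\chi^{(s+1)}_i=L^{(0)}(\chi^{(s)}_i)$ for $s\ge0$, with any fixed choice of the primitives, so that $\chi_i^{(s)}=(L^{(0)})^s(\Phi_i^{(0)})$. The Darboux–Bäcklund orbit uses the eigenfunctions cyclically: step $n=0,1,2,\dots$ uses the index $c=c(n)\in\{1,\dots,m\}$ with $c\equiv n+1\pmod m$, and with $T^{(n)}=\Phi^{(n)}_{c}D(\Phi^{(n)}_{c})^{-1}$, $$L^{(n+1)}=T^{(n)}L^{(n)}(T^{(n)})^{-1},\qquad \Phi^{(n+1)}_{c}=T^{(n)}\bigl(L^{(n)}(\Phi^{(n)}_{c})\bigr),\qquad \Phi^{(n+1)}_i=T^{(n)}(\Phi^{(n)}_i)\quad(i\ne c),$$ where $T^{(n)}(f)=\Phi_c^{(n)}\,\partial\bigl((\Phi_c^{(n)})^{-1}f\bigr)$, and where the powers of $L^{(n)}$ act on eigenfunctions through the intertwining relation $L^{(n+1)}T^{(n)}=T^{(n)}L^{(n)}$: starting from $(L^{(0)})^s(\Phi_i^{(0)})=\chi_i^{(s)}$, one puts, for all $s\ge0$, $$(L^{(n+1)})^s(\Phi_i^{(n+1)})=T^{(n)}\bigl((L^{(n)})^s(\Phi_i^{(n)})\bigr)\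 (i\ne c),\qquad (L^{(n+1)})^s(\Phi_c^{(n+1)})=T^{(n)}\bigl((L^{(n)})^{s+1}(\Phi_c^{(n)})\bigr).$$ **Proposition.** Let $k\ge0$, $1\le l\le m$, $N=km+l$, and suppose that $\Phi^{(n)}_{c(n)}$ is invertible for every $0\le n<N$. Then: 1. There are $\Psi^{(n)}_i$ ($0\le n\le N$, $1\le i\le m$), starting from the given $\Psi^{(0)}_i$, such that each $L^{(n)}$ is a Lax operator of $\mathsf{cKP}_{r,m}$ with eigenfunctions $\Phi_i^{(n)}$ and adjoint eigenfunctions $\Psi_i^{(n)}$; in particular $$L^{(km+l)}=D^r+\sum_{j=0}^{r-2}u_j^{(km+l)}D^j+\sum_{i=1}^m\Phi_i^{(km+l)}D^{-1}\Psi_i^{(km+l)}.$$ For $0\le n<N$ and $c=c(n)$ there are primitives $S_i=\partial^{-1}(\Psi^{(n)}_i\Phi^{(n)}_{c})$ as above (with respect to $L^{(n)}$) such that $\Phi^{(n+1)}_{c}=T^{(n)}\bigl(L^{(n)}_+(\Phi^{(n)}_{c})+\sum_i\Phi^{(n)}_iS_i\bigr)$, $\ \Psi^{(n+1)}_{c}=(\Phi^{(n)}_{c})^{-1}$,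 and $\Psi^{(n+1)}_i=-(\Phi^{(n)}_{c})^{-1}S_i$ for $i\ne c$. 2. Let $W[f_1,\dots,f_q]=\det(\partial^{a-1}f_b)_{a,b=1}^q$, and let $W_N$ be the Wronskian of the first $N=km+l$ functions in the list $\Phi^{(0)}_1,\dots,\Phi^{(0)}_m,\chi^{(1)}_1,\dots,\chi^{(1)}_m,\chi_1^{(2)},\dots$ (the last one is $\chi^{(k)}_l$). Put $\chi^{(k_\pm)}_i=\chi^{(k+1)}_i$ for $i\le l$ and $\chi^{(k_\pm)}_i=\chi^{(k)}_i$ for $i>l$. Then $W_N$ is invertible and, for $1\le i\le m$, $$\Phi_i^{(km+l)}=T^{(N-1)}\cdots T^{(1)}T^{(0)}\bigl(\chi_i^{(k_\pm)}\bigr)=\frac{W\bigl[\Phi^{(0)}_1,\dots,\Phi^{(0)}_m,\chi^{(1)}_1,\dots,\chi^{(k)}_l,\chi^{(k_\pm)}_i\bigr]}{W\bigl[\Phi^{(0)}_1,\dots,\Phi^{(0)}_m,\chi^{(1)}_1,\dots,\chi^{(k)}_l\bigr]}.$$ 3. $\prod_{n=0}^{N-1}\Phi^{(n)}_{c(n)}=W_N$,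 and if $\tau^{(0)}$ is a tau-function of $L^{(0)}$, then $$\tau^{(km+l)}=W\bigl[\Phi^{(0)}_1,\dots,\Phi^{(0)}_m,\chi^{(1)}_1,\dots,\chi^{(1)}_m,\dots,\chi^{(k)}_1,\dots,\chi^{(k)}_l\bigr]\,\tau^{(0)}$$ is a tau-function of $L^{(km+l)}$. -/

import Mathlib

/-- A commutative `ℚ`-algebra of functions of infinitely many times `t = (t₁ = x, t₂, t₃, …)`:
a commutative ring with pairwise commuting derivations `d k = ∂/∂t_k`, `k ≥ 1`. -/
class TimeAlgebra (A : Type*) [CommRing A] [Algebra ℚ A] where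
  d : ℕ+ → Derivation ℚ A A
  d_comm : ∀ (j k : ℕ+) (a : A), d j (d k a) = d k (d j a)

/-- Formal pseudo-differential operators `∑_j P_j D^j` (`j ∈ ℤ`, with `P_j = 0` for all large `j`),
given by their coefficients, written to the left of the powers of `D`. -/
def PDO (A : Type*) [CommRing A] : Type _ :=
  { c : ℤ → A // ∃ N : ℤ, ∀ j : ℤ, N < j → c j = 0 }

noncomputable section

namespace PDO

section Linear

variable {A : Type*} [CommRing A]

/-- The coefficient of `D^j`. -/
def coeff (P : PDO A) (j : ℤ) : A := P.1 j

theorem coeff_bdd (P : PDO A) : ∃ N : ℤ, ∀ j : ℤ, N < j → P.coeff j = 0 := P.2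

variable (A) in
/-- The coefficient sequences that are bounded above, as an additive group. -/
def coeffGroup : AddSubgroup (ℤ → A) where
  carrier := { c | ∃ N : ℤ, ∀ j : ℤ, N < j → c j = 0 }
  zero_mem' := ⟨0, fun _ _ => rfl⟩
  add_mem' := by
    rintro a b ⟨M, hM⟩ ⟨N, hN⟩
    refine ⟨max M N, fun j hj => ?_⟩
    simp [hM j (lt_of_le_of_lt (le_max_left _ _) hj), hN j (lt_of_le_of_lt (le_max_right _ _) hj)]
  neg_mem' := by
    rintro a ⟨M, hM⟩
    exact ⟨M, fun j hj => by simp [hM j hj]⟩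

/-- Addition is coefficientwise. -/
instance : AddCommGroup (PDO A) := inferInstanceAs (AddCommGroup (coeffGroup A))

/-- The operator `a D^j`. -/
def mono (a : A) (j : ℤ) : PDO A :=
  ⟨fun n => if n = j then a else 0, j, fun n hn => by simp [hn.ne']⟩

/-- The operator of multiplication by the function `a`. -/
def fn (a : A) : PDO A := mono a 0

/-- `D^j`, for an integer `j`. -/
def D (j : ℤ) : PDO A := mono 1 j

/-- The purely differential part `P₊ = ∑_{j ≥ 0} P_j D^j`. -/
def plus (P : PDO A) : PDO A :=
  ⟨fun j => if 0 ≤ j then P.coeff j else 0, by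
    obtain ⟨N, hN⟩ := P.coeff_bdd
    exact ⟨N, fun j hj => by simp [hN j hj]⟩⟩

/-- The purely pseudo-differential part `P₋ = ∑_{j < 0} P_j D^j`. -/
def minus (P : PDO A) : PDO A :=
  ⟨fun j => if j < 0 then P.coeff j else 0, 0, fun j hj => by
    simp [not_lt.mpr hj.le]⟩

end Linear

section Product

variable {A : Type*} [CommRing A] [Algebra ℚ A] [TimeAlgebra A]

/-- The derivative `∂ = ∂/∂x = ∂/∂t₁` of functions. -/
def dx : Derivation ℚ A A := TimeAlgebra.d 1

/-- The product of pseudo-differential operators, determined by the generalized Leibniz rule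
`(a D^i)(b D^j) = ∑_{k ≥ 0} (i choose k) a (∂^k b) D^(i+j-k)`.
The sum below has only finitely many non-zero terms. -/
instance : Mul (PDO A) where
  mul P R := ⟨fun n => ∑ᶠ x : ℤ × ℕ,
      Ring.choose x.1 x.2 • (P.coeff x.1 * (dx (A := A))^[x.2] (R.coeff (n - x.1 + x.2))), by
    obtain ⟨M, hM⟩ := P.coeff_bdd
    obtain ⟨N, hN⟩ := R.coeff_bdd
    refine ⟨M + N, fun n hn => ?_⟩
    refine (finsum_congr fun x => ?_).trans finsum_zero
    by_cases hx : M < x.1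
    · simp [hM _ hx]
    · have h0 : R.coeff (n - x.1 + x.2) = 0 := hN _ (by omega)
      rw [h0, iterate_map_zero]
      simp⟩

instance : One (PDO A) := ⟨fn 1⟩

/-- Powers `P^n = P ⋯ P`. -/
def npow (P : PDO A) : ℕ → PDO A
  | 0 => 1
  | n + 1 => npow P n * P

instance : Pow (PDO A) ℕ := ⟨npow⟩

/-- `∂P/∂t_k`: differentiation of all coefficients. -/
def dt (k : ℕ+) (P : PDO A) : PDO A :=
  ⟨fun j => TimeAlgebra.d k (P.coeff j), by
    obtain ⟨N, hN⟩ := P.coeff_bdd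
    exact ⟨N, fun j hj => by simp [hN j hj]⟩⟩

/-- The action `P₊(f) = ∑_{j ≥ 0} P_j ∂^j f` of the differential part of `P` on a function. -/
def plusAct (P : PDO A) (f : A) : A :=
  ∑ᶠ j : ℕ, P.coeff j * (dx (A := A))^[j] f

/-- The action `(P₊)^*(f) = ∑_{j ≥ 0} (-∂)^j (P_j f)` of the formal adjoint of the differential
part of `P` on a function. -/
def plusAdjAct (P : PDO A) (f : A) : A :=
  ∑ᶠ j : ℕ, (-1 : A) ^ j * (dx (A := A))^[j] (P.coeff j * f)

end Product

end PDO

open PDO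

section Hierarchy

variable {A : Type*} [CommRing A] [Algebra ℚ A] [TimeAlgebra A]

/-- `φ` is an eigenfunction: `∂φ/∂t_k = L^{k/r}₊(φ)` for all `k ≥ 1`, where `Q = L^{1/r}`. -/
def IsEigenfunction (Q : PDO A) (φ : A) : Prop :=
  ∀ k : ℕ+, TimeAlgebra.d k φ = plusAct (Q ^ (k : ℕ)) φ

/-- `ψ` is an adjoint eigenfunction: `∂ψ/∂t_k = -(L^*)^{k/r}₊(ψ)` for all `k ≥ 1`,
where `Q = L^{1/r}`. -/
def IsAdjointEigenfunction (Q : PDO A) (ψ : A) : Prop :=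
  ∀ k : ℕ+, TimeAlgebra.d k ψ = -plusAdjAct (Q ^ (k : ℕ)) ψ

/-- `L` is a Lax operator of the constrained KP hierarchy `cKP_{r,m}` with eigenfunctions
`Φ₁, …, Φ_m` and adjoint eigenfunctions `Ψ₁, …, Ψ_m`; here `Q = L^{1/r}`. -/
structure IsCKP (r : ℕ) {m : ℕ} (L Q : PDO A) (Φ Ψ : Fin m → A) : Prop where
  /-- `Q = D + ∑_{i ≥ 0} v_i D^{-i-1}`. -/
  root_top : ∀ j : ℤ, 1 < j → Q.coeff j = 0
  root_one : Q.coeff 1 = 1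
  root_zero : Q.coeff 0 = 0
  /-- `Q^r = L`. -/
  root_pow : Q ^ r = L
  /-- `L = D^r + ∑_{j=0}^{r-2} u_j D^j + ∑_{i=1}^m Φ_i D^{-1} Ψ_i`. -/
  form : ∃ u : ℕ → A,
    L = D (r : ℤ) + ∑ j ∈ Finset.range (r - 1), mono (u j) (j : ℤ)
      + ∑ i, fn (Φ i) * D (-1) * fn (Ψ i)
  /-- `∂L/∂t_k = [L^{k/r}₊, L]`. -/
  lax : ∀ k : ℕ+, dt k L = plus (Q ^ (k : ℕ)) * L - L * plus (Q ^ (k : ℕ))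
  eigen : ∀ i, IsEigenfunction Q (Φ i)
  adjoint_eigen : ∀ i, IsAdjointEigenfunction Q (Ψ i)

/-- `S = ∂⁻¹(ψ f)`, for an adjoint eigenfunction `ψ` and an eigenfunction `f`. The equation for
`t₁ = x` says `∂S = ψ f`; those for the other times fix the primitive up to an absolute constant.
They are what `∂/∂t_k (D⁻¹ ψ)(f)` is by the evolution equations of `ψ` and `f`: with
`B = L^{k/r}₊` one has `∂_k (ψ f) = ψ B(f) - B^*(ψ) f`, and
`D⁻¹ ψ B - D⁻¹ B^*(ψ) = (D⁻¹ ψ B)₊`. -/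
def IsPotential (Q : PDO A) (f ψ S : A) : Prop :=
  ∀ k : ℕ+, TimeAlgebra.d k S = plusAct (D (-1) * fn ψ * plus (Q ^ (k : ℕ))) f

/-- `g` is a value of `L(f) = L₊(f) + ∑_i Φ_i ∂⁻¹(Ψ_i f)`, with the primitives
`S_i = ∂⁻¹(Ψ_i f)`. -/
def IsActionWith {m : ℕ} (L Q : PDO A) (Φ Ψ : Fin m → A) (S : Fin m → A) (f g : A) : Prop :=
  (∀ i, IsPotential Q f (Ψ i) (S i)) ∧ g = plusAct L f + ∑ i, Φ i * S i

/-- The generating series `-∑_{n ≥ 1} (λ^n / n) ∂_n`, a power series in `λ` whose coefficients are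
operators on functions. -/
def shiftExponent (A : Type*) [CommRing A] [Algebra ℚ A] [TimeAlgebra A] :
    PowerSeries (Module.End ℚ A) :=
  PowerSeries.mk fun n => if h : 0 < n then
    (-(1 / (n : ℚ))) • (TimeAlgebra.d (A := A) ⟨n, h⟩ : Module.End ℚ A) else 0

/-- `p_n(-[∂])`, the coefficient of `λ^n` in `exp(-∑_{j ≥ 1} (λ^j / j) ∂_j)`, where `p_n` are the
Schur polynomials, `exp(∑_{j ≥ 1} λ^j t_j) = ∑_n λ^n p_n(t)`. Only the first `n + 1` terms of the
exponential series contribute, as the exponent has no constant term. -/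
def schurShift (n : ℕ) : Module.End ℚ A :=
  ∑ k ∈ Finset.range (n + 1),
    (1 / (k.factorial : ℚ)) • PowerSeries.coeff n (shiftExponent A ^ k)

/-- `τ` is a tau-function of the Lax operator `L = Q^r`: the operator
`W = ∑_{n ≥ 0} (p_n(-[∂])τ / τ) D^{-n}` is a dressing operator, that is `L^{1/r} = W D W⁻¹` (hence
`L = W D^r W⁻¹`), and `W` satisfies the Wilson-Sato equations `∂W/∂t_k = -L^{k/r}₋ W`. -/
def IsTau (Q : PDO A) (τ : A) : Prop :=
  IsUnit τ ∧ ∃ W : PDO A,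
    (∀ j : ℤ, 0 < j → W.coeff j = 0) ∧
    (∀ n : ℕ, τ * W.coeff (-(n : ℤ)) = schurShift n τ) ∧
    Q * W = W * D 1 ∧
    ∀ k : ℕ+, dt k W = -(minus (Q ^ (k : ℕ)) * W)

/-- The Wronskian `W[f_1, …, f_n] = det (∂^{i-1} f_j)`. -/
def wronskian {n : ℕ} (f : Fin n → A) : A :=
  Matrix.det (Matrix.of fun i j : Fin n => (dx (A := A))^[(i : ℕ)] (f j))

/-- The operator `T = φ D φ⁻¹`. -/
def dbOp (φ : A) : PDO A := fn φ * D 1 * fn (Ring.inverse φ)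

/-- Its inverse `T⁻¹ = φ D⁻¹ φ⁻¹`. -/
def dbOpInv (φ : A) : PDO A := fn φ * D (-1) * fn (Ring.inverse φ)

/-- The action `T(f) = φ ∂(φ⁻¹ f)` of `T = φ D φ⁻¹` on functions. -/
def dbAct (φ f : A) : A := φ * dx (Ring.inverse φ * f)

section Orbit

variable {m : ℕ} [NeZero m]

/-- The eigenfunctions are used cyclically: step `n` (`n = 0, 1, 2, …`) is performed with
the eigenfunction whose (zero-based) number is `n mod m`. -/
def stepIdx (m : ℕ) [NeZero m] (n : ℕ) : Fin m := Fin.ofNat m n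

/-- The functions `(L^{(n)})^s(Φ_i^{(n)})` along the orbit, where `χ s i = (L^{(0)})^s(Φ_i^{(0)})`.
By `L^{(n+1)} T^{(n)} = T^{(n)} L^{(n)}`, with `T = T^{(n)}` built from `φ = Φ_c^{(n)}`,
`c = stepIdx m n`, the new eigenfunctions are `Φ_i^{(n+1)} = T(Φ_i^{(n)})` for `i ≠ c` and
`Φ_c^{(n+1)} = T(L^{(n)}(Φ_c^{(n)}))`, and
`(L^{(n+1)})^s(T(f)) = T((L^{(n)})^s(f))`. -/
def orbitFn (χ : ℕ → Fin m → A) : ℕ → ℕ → Fin m → A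
  | 0 => χ
  | n + 1 => fun s i =>
      dbAct (orbitFn χ n 0 (stepIdx m n))
        (orbitFn χ n (if i = stepIdx m n then s + 1 else s) i)

/-- The eigenfunctions `Φ_i^{(n)}` of the orbit. -/
def orbitEigen (χ : ℕ → Fin m → A) (n : ℕ) (i : Fin m) : A := orbitFn χ n 0 i

/-- The function `Φ_c^{(n)}`, `c = stepIdx m n`, with which step `n` is performed. -/
def stepFn (χ : ℕ → Fin m → A) (n : ℕ) : A := orbitEigen χ n (stepIdx m n)

/-- `P^{(n)}`, where `P^{(0)} = P` and `P^{(n+1)} = T^{(n)} P^{(n)} (T^{(n)})⁻¹`. -/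
def orbitOp (χ : ℕ → Fin m → A) (P : PDO A) : ℕ → PDO A
  | 0 => P
  | n + 1 => dbOp (stepFn χ n) * orbitOp χ P n * dbOpInv (stepFn χ n)

/-- `T^{(n-1)} ⋯ T^{(1)} T^{(0)} (f)`. -/
def orbitChain (χ : ℕ → Fin m → A) : ℕ → A → A
  | 0, f => f
  | n + 1, f => dbAct (stepFn χ n) (orbitChain χ n f)

/-- The first `n` functions in the list
`χ_1^{(0)}, …, χ_m^{(0)}, χ_1^{(1)}, …, χ_m^{(1)}, χ_1^{(2)}, …`. -/
def chiList (χ : ℕ → Fin m → A) (n : ℕ) : Fin n → A :=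
  fun j => χ ((j : ℕ) / m) (stepIdx m j)

/-- The function `χ_i^{(k±)}` at step `km + l`: it is `χ_i^{(k+1)}` if `i` is among the first `l`
indices, and `χ_i^{(k)}` otherwise (`i` is zero-based here). -/
def chiPM (χ : ℕ → Fin m → A) (k l : ℕ) (i : Fin m) : A :=
  if (i : ℕ) < l then χ (k + 1) i else χ k i

end Orbit

end Hierarchy

end

/-! Fix one step, with φ = Φ_c, T = φ D φ⁻¹ and B = L^{k/r}₊; a prime marks transformed objects.
Most of the argument rests on one division fact: if a differential operator P annihilates φ, then P
T⁻¹ is again differential (`isDiff_mul_dbOpInv`). It is used three times.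

Since T(φ) = 0 for all times, T B + ∂_k T annihilates φ. Comparing orders then gives B' T = T B +
∂_k T (`plus_conj_pow_mul`), that is, ∂_k - B' = T (∂_k - B) T⁻¹. Hence the Lax equations survive,
and T maps eigenfunctions to eigenfunctions. With χ = -φ⁻¹ S, S = ∂⁻¹(ψ φ), and ψ B + ∂_k ψ = D E,
the operator E + χ B + ∂_k χ annihilates φ; this transports adjoint eigenfunctions and potentials
(`exists_adjoint_factor`). Finally T L₊ + ∑ Φ_i Ψ_i - ∑ Φ'_i Ψ'_i annihilates φ exactly because Φ'_c
= T(L(φ)); so L' again has an integral part with m terms (`exists_darboux_form`). As the action of L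
on eigenfunctions is intertwined by T (`IsActionWith.darboux`), the step can be iterated.

For the Wronskians, T^{(n-1)} ⋯ T^{(0)} is a monic differential operator of order n that annihilates
the first n functions of the list. A row operation with its coefficients gives W[f_1, …, f_n, g] =
W[f_1, …, f_n] · T^{(n-1)} ⋯ T^{(0)}(g) (`wronskian_snoc_chiList`), and the product formula
telescopes.

For tau-functions, one step must send τ to φ τ, with dressing operator T W D⁻¹ (`IsTau.darboux`).
This needs φ(t - [λ]) in terms of φ, ∂φ and the first coefficient w₁ of W. The shift acts on the
wave function and on every eigenfunction by the same differential operators P_n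
(`exists_shift_operator`). On the wave function, P_n is seen to have order 0 for n ≥ 2, which
determines it. -/

noncomputable section

namespace PDO

/-! ### Coefficients and orders of pseudo-differential operators -/

section Additive

variable {A : Type*} [CommRing A]

@[ext] theorem ext {P R : PDO A} (h : ∀ j, P.coeff j = R.coeff j) : P = R :=
  Subtype.ext (funext h)

@[simp] theorem coeff_add (P R : PDO A) (j : ℤ) : (P + R).coeff j = P.coeff j + R.coeff j := rfl
@[simp] theorem coeff_zero (j : ℤ) : (0 : PDO A).coeff j = 0 := rfl
@[simp] theorem coeff_neg (P : PDO A) (j : ℤ) : (-P).coeff j = -P.coeff j := rfl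
@[simp] theorem coeff_sub (P R : PDO A) (j : ℤ) : (P - R).coeff j = P.coeff j - R.coeff j := rfl

theorem coeff_mono (a : A) (i j : ℤ) : (mono a i).coeff j = if j = i then a else 0 := rfl
theorem coeff_fn (a : A) (j : ℤ) : (fn a).coeff j = if j = 0 then a else 0 := rfl
theorem coeff_D (i j : ℤ) : (D i : PDO A).coeff j = if j = i then 1 else 0 := rfl
theorem coeff_plus (P : PDO A) (j : ℤ) : (plus P).coeff j = if 0 ≤ j then P.coeff j else 0 := rfl
theorem coeff_minus (P : PDO A) (j : ℤ) : (minus P).coeff j = if j < 0 then P.coeff j else 0 := rfl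

/-- The coefficient of `D^j` as an additive map. -/
def coeffHom (j : ℤ) : PDO A →+ A where
  toFun P := P.coeff j
  map_zero' := rfl
  map_add' _ _ := rfl

theorem coeff_sum {ι : Type*} (s : Finset ι) (f : ι → PDO A) (j : ℤ) :
    (∑ i ∈ s, f i).coeff j = ∑ i ∈ s, (f i).coeff j :=
  map_sum (coeffHom j) f s

/-- `P` has order at most `N`. -/
def OrdLE (P : PDO A) (N : ℤ) : Prop := ∀ j : ℤ, N < j → P.coeff j = 0

theorem exists_ordLE (P : PDO A) : ∃ N, OrdLE P N := P.coeff_bdd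

theorem OrdLE.mono {P : PDO A} {M N : ℤ} (h : OrdLE P M) (hMN : M ≤ N) : OrdLE P N :=
  fun j hj => h j (by omega)

theorem OrdLE.add {P R : PDO A} {N : ℤ} (hP : OrdLE P N) (hR : OrdLE R N) : OrdLE (P + R) N :=
  fun j hj => by simp [hP j hj, hR j hj]

theorem OrdLE.neg {P : PDO A} {N : ℤ} (hP : OrdLE P N) : OrdLE (-P) N :=
  fun j hj => by simp [hP j hj]

theorem OrdLE.sub {P R : PDO A} {N : ℤ} (hP : OrdLE P N) (hR : OrdLE R N) : OrdLE (P - R) N :=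
  fun j hj => by simp [hP j hj, hR j hj]

theorem OrdLE.sum {ι : Type*} {s : Finset ι} {f : ι → PDO A} {N : ℤ}
    (h : ∀ i ∈ s, OrdLE (f i) N) : OrdLE (∑ i ∈ s, f i) N := fun j hj => by
  rw [coeff_sum]
  exact Finset.sum_eq_zero fun i hi => h i hi j hj

theorem ordLE_mono (a : A) (j : ℤ) : OrdLE (PDO.mono a j) j :=
  fun n hn => by simp [coeff_mono, hn.ne']

theorem ordLE_fn (a : A) : OrdLE (fn a) 0 := ordLE_mono a 0

theorem ordLE_D (j : ℤ) : OrdLE (D j : PDO A) j := ordLE_mono 1 j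

theorem ordLE_minus (P : PDO A) : OrdLE (minus P) (-1) := fun j hj => by
  rw [coeff_minus, if_neg (by omega)]

theorem plus_add_minus (P : PDO A) : plus P + minus P = P := by
  ext j
  rw [coeff_add, coeff_plus, coeff_minus]
  by_cases h : 0 ≤ j
  · simp [h, not_lt.mpr h]
  · simp [h, not_le.mp h]

/-- An operator is a finite sum of monomials, up to operators of arbitrarily low order. -/
theorem exists_truncation (P : PDO A) (a : ℤ) :
    ∃ s : Finset ℤ, OrdLE (P - ∑ j ∈ s, PDO.mono (P.coeff j) j) a := by
  obtain ⟨N, hN⟩ := P.exists_ordLE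
  refine ⟨Finset.Ioc a N, fun j hj => ?_⟩
  rw [coeff_sub, coeff_sum]
  simp only [coeff_mono]
  rw [Finset.sum_ite_eq]
  split_ifs with h
  · simp
  · rw [hN j (by simp at h; omega), sub_zero]

/-- Additive maps that shift the order by a bounded amount agree if they agree on monomials. -/
theorem addHom_ext (F G : PDO A →+ PDO A) {c : ℤ}
    (hF : ∀ a X, OrdLE X a → OrdLE (F X) (a + c)) (hG : ∀ a X, OrdLE X a → OrdLE (G X) (a + c))
    (h : ∀ a j, F (PDO.mono a j) = G (PDO.mono a j)) : F = G := by
  ext X n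
  obtain ⟨s, hs⟩ := X.exists_truncation (n - c - 1)
  have h1 := hF _ _ hs n (by omega)
  have h2 := hG _ _ hs n (by omega)
  rw [map_sub, map_sum, coeff_sub, sub_eq_zero] at h1 h2
  rw [h1, h2]
  simp only [h]

end Additive

/-! ### The ring of pseudo-differential operators -/

section Ring

variable {A : Type*} [CommRing A] [Algebra ℚ A] [TimeAlgebra A]

theorem coeff_mul (P R : PDO A) (n : ℤ) : (P * R).coeff n = ∑ᶠ x : ℤ × ℕ,
    Ring.choose x.1 x.2 • (P.coeff x.1 * (dx (A := A))^[x.2] (R.coeff (n - x.1 + x.2))) := rfl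

theorem mul_term_eq_zero {P R : PDO A} {M N : ℤ} (hP : OrdLE P M) (hR : OrdLE R N) {n : ℤ}
    {x : ℤ × ℕ} (hx : M < x.1 ∨ N < n - x.1 + x.2) :
    Ring.choose x.1 x.2 • (P.coeff x.1 * (dx (A := A))^[x.2] (R.coeff (n - x.1 + x.2))) = 0 := by
  rcases hx with hx | hx
  · simp [hP _ hx]
  · rw [hR _ hx, iterate_map_zero]
    simp

theorem mul_support_finite (P R : PDO A) (n : ℤ) :
    (Function.support fun x : ℤ × ℕ => Ring.choose x.1 x.2 •
      (P.coeff x.1 * (dx (A := A))^[x.2] (R.coeff (n - x.1 + x.2)))).Finite := by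
  obtain ⟨M, hM⟩ := P.exists_ordLE
  obtain ⟨N, hN⟩ := R.exists_ordLE
  refine (Finset.Icc (n - N) M ×ˢ Finset.range (N - n + M + 1).toNat).finite_toSet.subset ?_
  intro x hx
  by_contra hx'
  refine hx (mul_term_eq_zero hM hN ?_)
  simp only [Finset.coe_product, Set.mem_prod, Finset.mem_coe, Finset.mem_Icc,
    Finset.mem_range] at hx'
  omega

theorem OrdLE.mul {P R : PDO A} {M N : ℤ} (hP : OrdLE P M) (hR : OrdLE R N) :
    OrdLE (P * R) (M + N) := fun n hn => by
  rw [coeff_mul]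
  exact (finsum_congr fun x => mul_term_eq_zero hP hR (by omega)).trans finsum_zero

protected theorem mul_add (P R S : PDO A) : P * (R + S) = P * R + P * S := by
  ext n
  rw [coeff_add, coeff_mul, coeff_mul, coeff_mul,
    ← finsum_add_distrib (mul_support_finite P R n) (mul_support_finite P S n)]
  refine finsum_congr fun x => ?_
  rw [coeff_add, iterate_map_add, mul_add, smul_add]

protected theorem add_mul (P R S : PDO A) : (P + R) * S = P * S + R * S := by
  ext n
  rw [coeff_add, coeff_mul, coeff_mul, coeff_mul,
    ← finsum_add_distrib (mul_support_finite P S n) (mul_support_finite R S n)]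
  refine finsum_congr fun x => ?_
  rw [coeff_add, add_mul, smul_add]

/-- Left multiplication as an additive map. -/
def mulLeftHom (P : PDO A) : PDO A →+ PDO A :=
  AddMonoidHom.mk' (fun X => P * X) (PDO.mul_add P)

/-- Right multiplication as an additive map. -/
def mulRightHom (P : PDO A) : PDO A →+ PDO A :=
  AddMonoidHom.mk' (fun X => X * P) (fun X Y => PDO.add_mul X Y P)

/-- All terms with k ≥ K vanish because `R` has order at most `N`. The cutoff `K` is left free so
that expansions of different products can be compared over a common range. -/
theorem coeff_mono_mul (a : A) (i : ℤ) {R : PDO A} {N : ℤ} (hR : OrdLE R N) (n : ℤ) {K : ℕ}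
    (hK : N - n + i < K) : (PDO.mono a i * R).coeff n =
      a * ∑ k ∈ Finset.range K,
        Ring.choose i k • (dx (A := A))^[k] (R.coeff (n - i + k)) := by
  rw [coeff_mul, finsum_eq_sum_of_support_subset (s := {i} ×ˢ Finset.range K)]
  · rw [Finset.sum_product, Finset.sum_singleton, Finset.mul_sum]
    refine Finset.sum_congr rfl fun k _ => ?_
    simp only [coeff_mono, if_true, mul_smul_comm]
  · intro x hx
    by_contra hx'
    refine hx ?_
    simp only [Finset.coe_product, Set.mem_prod, Finset.mem_coe, Finset.mem_singleton,
      Finset.mem_range, not_and_or] at hx'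
    by_cases hi : x.1 = i
    · have h0 : R.coeff (n - x.1 + x.2) = 0 := hR _ (by omega)
      simp only [h0, iterate_map_zero, mul_zero, smul_zero]
    · simp [coeff_mono, hi]

theorem coeff_D_mul (i : ℤ) {R : PDO A} {N : ℤ} (hR : OrdLE R N) (n : ℤ) {K : ℕ}
    (hK : N - n + i < K) : (D i * R).coeff n =
      ∑ k ∈ Finset.range K, Ring.choose i k • (dx (A := A))^[k] (R.coeff (n - i + k)) := by
  rw [D, coeff_mono_mul 1 i hR n hK, one_mul]

theorem coeff_fn_mul (a : A) (R : PDO A) (n : ℤ) : (fn a * R).coeff n = a * R.coeff n := by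
  obtain ⟨N, hN⟩ := R.exists_ordLE
  rw [fn, coeff_mono_mul a 0 hN n (K := (N - n).toNat + 1) (by push_cast; omega),
    Finset.sum_range_succ']
  simp [Ring.choose_zero_succ]

theorem coeff_D_one_mul (R : PDO A) (n : ℤ) :
    (D 1 * R).coeff n = R.coeff (n - 1) + dx (R.coeff n) := by
  obtain ⟨N, hN⟩ := R.exists_ordLE
  rw [coeff_D_mul 1 hN n (K := (N - n).toNat + 2) (by push_cast; omega),
    Finset.sum_range_succ', Finset.sum_range_succ', Finset.sum_eq_zero]
  · simp [add_comm]
  · intro k _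
    have : Ring.choose (1 : ℤ) (k + 1 + 1) = 0 := by
      have := Ring.choose_natCast (R := ℤ) 1 (k + 1 + 1)
      rwa [Nat.choose_eq_zero_of_lt (by omega), Nat.cast_one, Nat.cast_zero] at this
    rw [this, zero_smul]

theorem D_zero_mul (R : PDO A) : D 0 * R = R := by
  ext n
  rw [show (D 0 : PDO A) = fn 1 from rfl, coeff_fn_mul, one_mul]

/-- This is Pascal's rule for binomial coefficients with integer upper entry. -/
theorem D_add_one_mul (i : ℤ) (R : PDO A) : D (i + 1) * R = D 1 * (D i * R) := by
  ext n
  obtain ⟨N, hN⟩ := R.exists_ordLE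
  obtain ⟨K, hK⟩ : ∃ K : ℕ, N - n + i < K := ⟨(N - n + i).toNat + 1, by push_cast; omega⟩
  rw [coeff_D_one_mul, coeff_D_mul (i + 1) hN n (K := K + 1) (by push_cast; omega),
    coeff_D_mul i hN (n - 1) (K := K + 1) (by push_cast; omega), coeff_D_mul i hN n hK,
    Finset.sum_range_succ', Finset.sum_range_succ' _ K, map_sum, add_right_comm,
    ← Finset.sum_add_distrib]
  congr 1
  · refine Finset.sum_congr rfl fun k _ => ?_
    rw [Ring.choose_succ_succ, add_smul, map_zsmul, add_comm,
      show n - (i + 1) + ((k + 1 : ℕ) : ℤ) = n - i + k by push_cast; ring,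
      show n - 1 - i + ((k + 1 : ℕ) : ℤ) = n - i + k by push_cast; ring,
      Function.iterate_succ_apply']
  · simp [show n - (i + 1) = n - 1 - i by ring]

/-- The coefficient of D^(j+1) in D X is X_j + ∂X_{j+1}, so D X determines X by descending recursion
from the top order. This carries identities from D^(i+1) down to D^i for negative i. -/
theorem D_one_mul_injective {X Y : PDO A} (h : D 1 * X = D 1 * Y) : X = Y := by
  obtain ⟨M, hM⟩ := X.exists_ordLE
  obtain ⟨N, hN⟩ := Y.exists_ordLE
  have key : ∀ (k : ℕ) (j : ℤ), max M N - k < j → X.coeff j = Y.coeff j := by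
    intro k
    induction k with
    | zero =>
      intro j hj
      rw [hM j (by omega), hN j (by omega)]
    | succ k ih =>
      intro j hj
      have h1 := congrArg (fun Z => coeff Z (j + 1)) h
      simp only [coeff_D_one_mul, ih (j + 1) (by push_cast at hj; omega)] at h1
      simpa using h1
  ext j
  exact key (max M N - j + 1).toNat j (by omega)

theorem fn_mul_mul (a : A) (X Y : PDO A) : fn a * (X * Y) = fn a * X * Y := by
  ext n
  rw [coeff_fn_mul, coeff_mul, coeff_mul, mul_finsum' _ _ (mul_support_finite X Y n)]
  refine finsum_congr fun x => ?_
  rw [coeff_fn_mul, mul_smul_comm, mul_assoc]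

theorem mono_eq (a : A) (i : ℤ) : PDO.mono a i = fn a * D i := by
  ext n
  rw [coeff_fn_mul, coeff_mono, coeff_D]
  simp

theorem D_one_mul_fn_mul (b : A) (Z : PDO A) :
    D 1 * (fn b * Z) = fn b * (D 1 * Z) + fn (dx b) * Z := by
  ext n
  simp only [coeff_add, coeff_D_one_mul, coeff_fn_mul, Derivation.leibniz, smul_eq_mul]
  ring

theorem D_one_mul_mono (b : A) (j : ℤ) :
    D 1 * PDO.mono b j = PDO.mono b (j + 1) + PDO.mono (dx b) j := by
  ext n
  simp only [coeff_add, coeff_D_one_mul, coeff_mono]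
  congr 1
  · simp [sub_eq_iff_eq_add]
  · split_ifs <;> simp

theorem D_one_mul_mul (X Y : PDO A) : D 1 * (X * Y) = D 1 * X * Y := by
  obtain ⟨N, hN⟩ := Y.exists_ordLE
  have := addHom_ext ((mulLeftHom (D 1)).comp (mulRightHom Y))
    ((mulRightHom Y).comp (mulLeftHom (D 1))) (c := 1 + N)
    (fun a X hX => ((ordLE_D 1).mul (hX.mul hN)).mono (by omega))
    (fun a X hX => (((ordLE_D 1).mul hX).mul hN).mono (by omega))
    (fun b j => by
      change D 1 * (PDO.mono b j * Y) = D 1 * PDO.mono b j * Y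
      rw [D_one_mul_mono, PDO.add_mul, mono_eq, mono_eq, mono_eq, ← fn_mul_mul, ← fn_mul_mul,
        ← fn_mul_mul, D_one_mul_fn_mul, ← D_add_one_mul])
  exact DFunLike.congr_fun this X

theorem D_mul_mul (i : ℤ) (X Y : PDO A) : D i * (X * Y) = D i * X * Y := by
  induction i using Int.induction_on with
  | zero => rw [D_zero_mul, D_zero_mul]
  | succ i ih => rw [D_add_one_mul, ih, D_one_mul_mul, ← D_add_one_mul]
  | pred i ih =>
    apply D_one_mul_injective
    rw [← D_add_one_mul, sub_add_cancel, ih, D_one_mul_mul, ← D_add_one_mul, sub_add_cancel]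

/-- Both sides are additive in `P` and shift orders boundedly, so a monomial a D^j suffices. The
function a passes through termwise, and powers of D reduce to D itself, where associativity is the
Leibniz rule. -/
protected theorem mul_assoc (P X Y : PDO A) : P * X * Y = P * (X * Y) := by
  obtain ⟨M, hM⟩ := X.exists_ordLE
  obtain ⟨N, hN⟩ := Y.exists_ordLE
  have := addHom_ext ((mulRightHom Y).comp (mulRightHom X)) (mulRightHom (X * Y)) (c := M + N)
    (fun a P hP => ((hP.mul hM).mul hN).mono (by omega))
    (fun a P hP => hP.mul (hM.mul hN))
    (fun a j => by
      change PDO.mono a j * X * Y = PDO.mono a j * (X * Y)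
      rw [mono_eq, ← fn_mul_mul, ← fn_mul_mul, ← fn_mul_mul, D_mul_mul])
  exact DFunLike.congr_fun this P

protected theorem mul_one (P : PDO A) : P * fn 1 = P := by
  ext n
  rw [coeff_mul, finsum_eq_single _ ((n, 0) : ℤ × ℕ)]
  · simp [coeff_fn]
  · rintro ⟨i, k⟩ hik
    rcases k with _ | k
    · have : n - i ≠ 0 := fun h => hik (by rw [sub_eq_zero.mp h])
      simp [coeff_fn, this]
    · have : dx (A := A) (if n - i + ((k + 1 : ℕ) : ℤ) = 0 then 1 else 0) = 0 := by
        split_ifs <;> simp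
      simp only [coeff_fn, Function.iterate_succ_apply, this, iterate_map_zero, mul_zero,
        smul_zero]

instance instRing : Ring (PDO A) :=
  { (inferInstance : AddCommGroup (PDO A)), (inferInstance : Mul (PDO A)),
    (inferInstance : One (PDO A)) with
    left_distrib := PDO.mul_add
    right_distrib := PDO.add_mul
    zero_mul := fun P => (mulRightHom P).map_zero
    mul_zero := fun P => (mulLeftHom P).map_zero
    mul_assoc := PDO.mul_assoc
    one_mul := D_zero_mul
    mul_one := PDO.mul_one
    npow := fun n P => P ^ n
    npow_zero := fun _ => rfl
    npow_succ := fun _ _ => rfl }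

end Ring

end PDO

end

/-! ### Differential operators -/

noncomputable section

namespace PDO

variable {A : Type*} [CommRing A]

/-- `P` is a differential operator. -/
def IsDiff (P : PDO A) : Prop := ∀ j : ℤ, j < 0 → P.coeff j = 0

theorem isDiff_plus (P : PDO A) : IsDiff (plus P) := fun j hj => by
  rw [coeff_plus, if_neg (by omega)]

theorem isDiff_mono (a : A) {j : ℤ} (hj : 0 ≤ j) : IsDiff (PDO.mono a j) := fun n hn => by
  rw [coeff_mono, if_neg (by omega)]

theorem isDiff_fn (a : A) : IsDiff (fn a) := isDiff_mono a le_rfl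

theorem isDiff_D {j : ℤ} (hj : 0 ≤ j) : IsDiff (D j : PDO A) := isDiff_mono 1 hj

theorem IsDiff.add {P R : PDO A} (hP : IsDiff P) (hR : IsDiff R) : IsDiff (P + R) :=
  fun j hj => by simp [hP j hj, hR j hj]

theorem IsDiff.neg {P : PDO A} (hP : IsDiff P) : IsDiff (-P) :=
  fun j hj => by simp [hP j hj]

theorem IsDiff.sub {P R : PDO A} (hP : IsDiff P) (hR : IsDiff R) : IsDiff (P - R) :=
  fun j hj => by simp [hP j hj, hR j hj]

theorem IsDiff.sum {ι : Type*} {s : Finset ι} {f : ι → PDO A}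
    (h : ∀ i ∈ s, IsDiff (f i)) : IsDiff (∑ i ∈ s, f i) := fun j hj => by
  rw [coeff_sum]
  exact Finset.sum_eq_zero fun i hi => h i hi j hj

theorem plus_eq_self {P : PDO A} (hP : IsDiff P) : plus P = P := by
  ext j
  rw [coeff_plus]
  split_ifs with h
  · rfl
  · rw [hP j (by omega)]

theorem plus_eq_zero {P : PDO A} (hP : OrdLE P (-1)) : plus P = 0 := by
  ext j
  rw [coeff_plus]
  split_ifs with h
  · exact hP j (by omega)
  · rfl

theorem plus_add (P R : PDO A) : plus (P + R) = plus P + plus R := by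
  ext j
  simp only [coeff_add, coeff_plus]
  split_ifs <;> simp

theorem plus_eq_of_sub {P B : PDO A} (hB : IsDiff B) (h : OrdLE (P - B) (-1)) : plus P = B := by
  have := plus_add B (P - B)
  rwa [add_sub_cancel, plus_eq_self hB, plus_eq_zero h, add_zero] at this

theorem eq_fn_of_isDiff {P : PDO A} (hP : IsDiff P) (h : OrdLE P 0) : P = fn (P.coeff 0) := by
  ext j
  rw [coeff_fn]
  rcases lt_trichotomy j 0 with hj | rfl | hj
  · rw [hP j hj, if_neg hj.ne]
  · simp
  · rw [h j hj, if_neg hj.ne']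

variable [Algebra ℚ A] [TimeAlgebra A]

theorem coeff_mul_D (P : PDO A) (i n : ℤ) : (P * D i).coeff n = P.coeff (n - i) := by
  rw [coeff_mul, finsum_eq_single _ ((n - i, 0) : ℤ × ℕ)]
  · simp [coeff_D]
  · rintro ⟨p, k⟩ hpk
    rcases k with _ | k
    · have : n - p ≠ i := fun h => hpk (by rw [← h]; simp)
      simp [coeff_D, this]
    · have : dx (A := A) (if n - p + ((k + 1 : ℕ) : ℤ) = i then 1 else 0) = 0 := by
        split_ifs <;> simp
      simp only [coeff_D, Function.iterate_succ_apply, this, iterate_map_zero, mul_zero, smul_zero]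

theorem D_mul_D (i j : ℤ) : (D i * D j : PDO A) = D (i + j) := by
  ext n
  rw [coeff_mul_D, coeff_D, coeff_D]
  simp [sub_eq_iff_eq_add]

theorem D_zero : (D 0 : PDO A) = 1 := rfl

theorem D_mul_D_inv : (D 1 * D (-1) : PDO A) = 1 := D_mul_D 1 (-1)

theorem D_inv_mul_D : (D (-1) * D 1 : PDO A) = 1 := D_mul_D (-1) 1

variable (A) in
/-- Functions as operators. -/
def fnHom : A →+* PDO A where
  toFun := fn
  map_zero' := by ext j; simp [coeff_fn]
  map_one' := rfl
  map_add' a b := by ext j; simp only [coeff_add, coeff_fn]; split_ifs <;> simp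
  map_mul' a b := by ext j; simp only [coeff_fn_mul, coeff_fn, mul_ite, mul_zero]

theorem fn_add (a b : A) : fn (a + b) = fn a + fn b := map_add (fnHom A) a b
theorem fn_neg (a : A) : fn (-a) = -fn a := map_neg (fnHom A) a
theorem fn_mul (a b : A) : fn (a * b) = fn a * fn b := map_mul (fnHom A) a b
theorem fn_one : (fn 1 : PDO A) = 1 := rfl
theorem fn_zero : (fn 0 : PDO A) = 0 := map_zero (fnHom A)

theorem D_mul_fn (a : A) : D 1 * fn a = fn a * D 1 + fn (dx a) := by
  have := D_one_mul_fn_mul a (1 : PDO A)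
  simpa using this

theorem IsDiff.mul {P R : PDO A} (hP : IsDiff P) (hR : IsDiff R) : IsDiff (P * R) := by
  intro n hn
  rw [coeff_mul]
  refine (finsum_congr fun x => ?_).trans finsum_zero
  obtain ⟨i, k⟩ := x
  rcases lt_or_ge i 0 with hi | hi
  · simp [hP i hi]
  · rcases le_or_gt (k : ℤ) i with hk | hk
    · simp only
      rw [hR _ (by omega), iterate_map_zero, mul_zero, smul_zero]
    -- Here 0 ≤ i < k, so the binomial coefficient vanishes.
    · lift i to ℕ using hi
      have := Ring.choose_natCast (R := ℤ) i k
      rw [Nat.choose_eq_zero_of_lt (by omega), Nat.cast_zero] at this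
      exact (congrArg (· • _) this).trans (zero_smul ℤ _)

/-! ### Time derivatives of operators -/

section TimeDerivative

theorem coeff_dt (k : ℕ+) (P : PDO A) (j : ℤ) :
    (dt k P).coeff j = TimeAlgebra.d k (P.coeff j) := rfl

/-- `∂/∂t_k` as an additive map. -/
def dtHom (k : ℕ+) : PDO A →+ PDO A :=
  AddMonoidHom.mk' (dt k) fun P R => by ext j; simp [coeff_dt]

theorem dt_add (k : ℕ+) (P R : PDO A) : dt k (P + R) = dt k P + dt k R := map_add (dtHom k) P R
theorem dt_sub (k : ℕ+) (P R : PDO A) : dt k (P - R) = dt k P - dt k R := map_sub (dtHom k) P R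
theorem dt_sum (k : ℕ+) {ι : Type*} (s : Finset ι) (f : ι → PDO A) :
    dt k (∑ i ∈ s, f i) = ∑ i ∈ s, dt k (f i) := map_sum (dtHom k) f s

theorem dt_fn (k : ℕ+) (a : A) : dt k (fn a) = fn (TimeAlgebra.d k a) := by
  ext j
  rw [coeff_dt, coeff_fn, coeff_fn]
  split_ifs <;> simp

theorem dt_D (k : ℕ+) (i : ℤ) : dt k (D i : PDO A) = 0 := by
  ext j
  rw [coeff_dt, coeff_D]
  split_ifs <;> simp

theorem d_iterate (k : ℕ+) (n : ℕ) (a : A) :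
    TimeAlgebra.d k ((dx (A := A))^[n] a) = (dx (A := A))^[n] (TimeAlgebra.d k a) := by
  induction n generalizing a with
  | zero => rfl
  | succ n ih => rw [Function.iterate_succ_apply, ih, Function.iterate_succ_apply, dx,
      TimeAlgebra.d_comm]

theorem dt_mul (k : ℕ+) (P R : PDO A) : dt k (P * R) = dt k P * R + P * dt k R := by
  ext n
  rw [coeff_add, coeff_dt, coeff_mul, coeff_mul, coeff_mul,
    ← finsum_add_distrib (mul_support_finite (dt k P) R n) (mul_support_finite P (dt k R) n)]
  refine ((TimeAlgebra.d (A := A) k : A →ₗ[ℚ] A).toAddMonoidHom.map_finsum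
    (mul_support_finite P R n)).trans (finsum_congr fun x => ?_)
  change TimeAlgebra.d k _ = _
  rw [map_zsmul, Derivation.leibniz, d_iterate, coeff_dt, coeff_dt, smul_eq_mul, smul_eq_mul,
    ← smul_add]
  congr 1
  ring

theorem IsDiff.dt {P : PDO A} (hP : IsDiff P) (k : ℕ+) : IsDiff (dt k P) := fun j hj => by
  rw [coeff_dt, hP j hj, map_zero]

theorem OrdLE.dt {P : PDO A} {N : ℤ} (hP : OrdLE P N) (k : ℕ+) : OrdLE (dt k P) N :=
  fun j hj => by rw [coeff_dt, hP j hj, map_zero]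

end TimeDerivative

/-! ### Action of differential operators on functions -/

section Action

/-- Only the terms in which all derivatives fall on f reach D^0. Statements about the action thereby
become identities in the operator ring. -/
theorem plusAct_eq_coeff (P : PDO A) (f : A) : plusAct P f = (plus P * fn f).coeff 0 := by
  obtain ⟨N, hN⟩ := P.exists_ordLE
  rw [plusAct, finsum_eq_sum_of_support_subset (s := Finset.range (N.toNat + 1)), coeff_mul,
    finsum_eq_sum_of_support_subset
      (s := (Finset.range (N.toNat + 1)).image fun k : ℕ => ((k : ℤ), k)), Finset.sum_image]
  · refine Finset.sum_congr rfl fun k _ => ?_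
    have := Ring.choose_natCast (R := ℤ) k k
    simp only [Nat.choose_self, Nat.cast_one] at this
    simp only [this, one_smul, coeff_plus, coeff_fn]
    simp
  · intro a _ b _ h
    exact congrArg Prod.snd h
  · rintro ⟨i, k⟩ hx
    simp only [Finset.coe_image, Set.mem_image, Finset.mem_coe, Finset.mem_range, Prod.mk.injEq]
    by_contra hx'
    refine hx ?_
    simp only [coeff_plus, coeff_fn]
    by_cases hik : i = k
    · subst hik
      have : P.coeff k = 0 := hN _ (by
        by_contra h
        exact hx' ⟨k, by omega, rfl, rfl⟩)
      simp [this]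
    · rw [if_neg (by omega : ¬ (0 - i + (k : ℤ) = 0)), iterate_map_zero]
      simp
  · intro k hk
    simp only [Finset.mem_coe, Finset.mem_range]
    by_contra h
    exact hk (by simp only [hN k (by omega), zero_mul])

theorem plusAct_of_isDiff {P : PDO A} (hP : IsDiff P) (f : A) :
    plusAct P f = (P * fn f).coeff 0 := by
  rw [plusAct_eq_coeff, plus_eq_self hP]

theorem plusAct_plus (P : PDO A) (f : A) : plusAct (plus P) f = plusAct P f := by
  rw [plusAct_eq_coeff, plusAct_eq_coeff, plus_eq_self (isDiff_plus P)]

theorem plusAct_add (P R : PDO A) (f : A) : plusAct (P + R) f = plusAct P f + plusAct R f := by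
  simp only [plusAct_eq_coeff, plus_add, add_mul, coeff_add]

/-- The action on a fixed function as an additive map. -/
def plusActHom (f : A) : PDO A →+ A :=
  AddMonoidHom.mk' (fun P => plusAct P f) fun P R => plusAct_add P R f

theorem plusAct_sub (P R : PDO A) (f : A) : plusAct (P - R) f = plusAct P f - plusAct R f :=
  map_sub (plusActHom f) P R
theorem plusAct_neg (P : PDO A) (f : A) : plusAct (-P) f = -plusAct P f :=
  map_neg (plusActHom f) P
theorem plusAct_sum {ι : Type*} (s : Finset ι) (P : ι → PDO A) (f : A) :
    plusAct (∑ i ∈ s, P i) f = ∑ i ∈ s, plusAct (P i) f :=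
  map_sum (plusActHom f) P s

/-- The action of a fixed operator as an additive map. -/
def actHom (P : PDO A) : A →+ A :=
  AddMonoidHom.mk' (plusAct P) fun f g => by
    simp only [plusAct_eq_coeff, fn_add, mul_add, coeff_add]

theorem act_add (P : PDO A) (f g : A) : plusAct P (f + g) = plusAct P f + plusAct P g :=
  map_add (actHom P) f g
theorem act_sum {ι : Type*} (P : PDO A) (s : Finset ι) (f : ι → A) :
    plusAct P (∑ i ∈ s, f i) = ∑ i ∈ s, plusAct P (f i) :=
  map_sum (actHom P) f s

theorem plusAct_fn (a f : A) : plusAct (fn a) f = a * f := by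
  rw [plusAct_of_isDiff (isDiff_fn a), ← fn_mul, coeff_fn, if_pos rfl]

theorem plusAct_one (f : A) : plusAct 1 f = f := by
  rw [← fn_one, plusAct_fn, one_mul]

theorem plusAct_D (f : A) : plusAct (D 1) f = dx f := by
  rw [plusAct_of_isDiff (isDiff_D zero_le_one), coeff_D_one_mul]
  simp [coeff_fn]

/-- Division with remainder of `P f` by `D` on the right. -/
theorem exists_mul_fn_eq {P : PDO A} (hP : IsDiff P) (f : A) :
    ∃ G, IsDiff G ∧ P * fn f = fn (plusAct P f) + G * D 1 := by
  have hPf := hP.mul (isDiff_fn f)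
  refine ⟨(P * fn f - fn (plusAct P f)) * D (-1), fun j hj => ?_, ?_⟩
  · rw [coeff_mul_D, coeff_sub, coeff_fn]
    rcases eq_or_ne j (-1) with rfl | h
    · rw [plusAct_of_isDiff hP]
      simp
    · rw [hPf _ (by omega), if_neg (by omega), sub_zero]
  · rw [mul_assoc, D_inv_mul_D, mul_one]
    abel

/-- Modulo right multiples of D, the operator R f equals the function R(f). Such multiples, with a
differential cofactor, have no D^0 coefficient. -/
theorem plusAct_mul {P R : PDO A} (hP : IsDiff P) (hR : IsDiff R) (f : A) :
    plusAct (P * R) f = plusAct P (plusAct R f) := by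
  obtain ⟨G, hG, h⟩ := exists_mul_fn_eq hR f
  rw [plusAct_of_isDiff (hP.mul hR), mul_assoc, h, mul_add, coeff_add, ← mul_assoc, coeff_mul_D,
    (hP.mul hG) _ (by omega), add_zero, ← plusAct_of_isDiff hP]

theorem plusAct_fn_mul (a : A) {P : PDO A} (hP : IsDiff P) (f : A) :
    plusAct (fn a * P) f = a * plusAct P f := by
  rw [plusAct_mul (isDiff_fn a) hP, plusAct_fn]

theorem plusAct_mul_fn (a : A) {P : PDO A} (hP : IsDiff P) (f : A) :
    plusAct (P * fn a) f = plusAct P (a * f) := by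
  rw [plusAct_mul hP (isDiff_fn a), plusAct_fn]

theorem d_plusAct (k : ℕ+) {P : PDO A} (hP : IsDiff P) (f : A) :
    TimeAlgebra.d k (plusAct P f) = plusAct (dt k P) f + plusAct P (TimeAlgebra.d k f) := by
  rw [plusAct_of_isDiff hP, ← coeff_dt, dt_mul, coeff_add, dt_fn, plusAct_of_isDiff hP,
    plusAct_of_isDiff (hP.dt k)]

theorem choose_neg_one (k : ℕ) : Ring.choose (-1 : ℤ) k = (-1) ^ k := by
  induction k with
  | zero => simp
  | succ k ih =>
    have := Ring.choose_succ_succ (-1 : ℤ) k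
    rw [neg_add_cancel, Ring.choose_zero_succ, ih] at this
    rw [pow_succ]
    linarith

/-- As binom(-1, k) = (-1)^k, the coefficient of D⁻¹ collects exactly the terms (-∂)^k (P_k f), k ≥
0. -/
theorem coeff_neg_one_eq_plusAdjAct (P : PDO A) (f : A) :
    (D (-1) * (fn f * P)).coeff (-1) = plusAdjAct P f := by
  obtain ⟨N, hN⟩ := P.exists_ordLE
  have hN' : OrdLE (fn f * P) N := fun j hj => by rw [coeff_fn_mul, hN j hj, mul_zero]
  rw [coeff_D_mul (-1) hN' (-1) (K := N.toNat + 1) (by push_cast; omega), plusAdjAct,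
    finsum_eq_sum_of_support_subset (s := Finset.range (N.toNat + 1))]
  · refine Finset.sum_congr rfl fun k _ => ?_
    rw [choose_neg_one, coeff_fn_mul, zsmul_eq_mul]
    simp [mul_comm f]
  · intro k hk
    simp only [Finset.mem_coe, Finset.mem_range]
    by_contra h
    exact hk (by simp only [hN k (by omega), zero_mul, iterate_map_zero, mul_zero])

/-- Division with remainder of `f P` by `D` on the left. -/
theorem exists_fn_mul_eq {P : PDO A} (hP : IsDiff P) (f : A) :
    ∃ E, IsDiff E ∧ fn f * P = D 1 * E + fn (plusAdjAct P f) := by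
  set N := minus (D (-1) * (fn f * P)) with hN
  refine ⟨plus (D (-1) * (fn f * P)), isDiff_plus _, ?_⟩
  have h1 : fn f * P = D 1 * plus (D (-1) * (fn f * P)) + D 1 * N := by
    rw [← mul_add, plus_add_minus, ← mul_assoc, D_mul_D_inv, one_mul]
  have h2 : IsDiff (D 1 * N) := by
    rw [← sub_eq_iff_eq_add'] at h1
    rw [← h1]
    exact ((isDiff_fn f).mul hP).sub ((isDiff_D zero_le_one).mul (isDiff_plus _))
  have h3 : D 1 * N = fn (plusAdjAct P f) := by
    rw [eq_fn_of_isDiff h2 (((ordLE_D 1).mul (ordLE_minus _)).mono (by omega)), coeff_D_one_mul,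
      hN, coeff_minus, coeff_minus, ← coeff_neg_one_eq_plusAdjAct P]
    simp
  rw [← h3]
  exact h1

end Action

end PDO

end

noncomputable section

open PDO

variable {A : Type*} [CommRing A] [Algebra ℚ A] [TimeAlgebra A]

namespace PDO

/-! ### Powers of the root L^{1/r} -/

section Root

theorem ordLE_sub_D_of_coeff {Q : PDO A} (h2 : ∀ j : ℤ, 1 < j → Q.coeff j = 0)
    (h1 : Q.coeff 1 = 1) (h0 : Q.coeff 0 = 0) : OrdLE (Q - D 1) (-1) := by
  intro j hj
  rw [coeff_sub, coeff_D]
  rcases lt_trichotomy j 1 with h | rfl | h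
  · obtain rfl : j = 0 := by omega
    simp [h0]
  · simp [h1]
  · rw [h2 j h, if_neg h.ne', sub_zero]

theorem coeff_of_ordLE_sub_D {Q : PDO A} {n N : ℤ} (h : OrdLE (Q - D n) N) {j : ℤ} (hj : N < j) :
    Q.coeff j = if j = n then 1 else 0 := by
  have := h j hj
  rwa [coeff_sub, coeff_D, sub_eq_zero] at this

theorem npow_zero_eq (P : PDO A) : P ^ 0 = 1 := rfl

theorem npow_succ_eq (P : PDO A) (n : ℕ) : P ^ (n + 1) = P ^ n * P := rfl

/-- A root without a D^0 term has n-th power without a D^(n-1) term. This is why no u_{r-1} appears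
along the orbit. -/
theorem ordLE_pow_sub_D {Q : PDO A} (hQ : OrdLE (Q - D 1) (-1)) (n : ℕ) :
    OrdLE (Q ^ n - D (n : ℤ)) (n - 2) := by
  induction n with
  | zero =>
    rw [npow_zero_eq, Nat.cast_zero, D_zero, sub_self]
    exact fun _ _ => rfl
  | succ n ih =>
    have hQ1 : OrdLE Q 1 := by
      have := (hQ.mono (by omega : (-1 : ℤ) ≤ 1)).add (ordLE_D (A := A) 1)
      rwa [sub_add_cancel] at this
    have h : Q ^ (n + 1) - D ((n + 1 : ℕ) : ℤ)
        = (Q ^ n - D (n : ℤ)) * Q + D (n : ℤ) * (Q - D 1) := by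
      rw [npow_succ_eq, Nat.cast_succ, ← D_mul_D]
      noncomm_ring
    rw [h]
    refine ((ih.mul hQ1).mono ?_).add (((ordLE_D (n : ℤ)).mul hQ).mono ?_) <;> push_cast <;> omega

theorem plus_pow_one {Q : PDO A} (hQ : OrdLE (Q - D 1) (-1)) :
    plus (Q ^ ((1 : ℕ+) : ℕ)) = D 1 := by
  refine plus_eq_of_sub (isDiff_D zero_le_one) ?_
  simpa using ordLE_pow_sub_D hQ 1

end Root

end PDO

/-! ### Eigenfunctions, adjoint eigenfunctions and potentials -/

section Eigenfunctions

theorem isEigenfunction_iff {Q : PDO A} {f : A} : IsEigenfunction Q f ↔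
    ∀ k : ℕ+, TimeAlgebra.d k f = plusAct (plus (Q ^ (k : ℕ))) f := by
  simp only [IsEigenfunction, plusAct_plus]

theorem plusAdjAct_plus (P : PDO A) (f : A) : plusAdjAct (plus P) f = plusAdjAct P f := by
  refine finsum_congr fun j => ?_
  rw [coeff_plus, if_pos (by omega)]

theorem coeff_D_inv_mul_fn (a : A) : (D (-1) * fn a).coeff (-1) = a := by
  rw [coeff_D_mul (-1) (ordLE_fn a) (-1) (K := 1) (by norm_num)]
  simp [coeff_fn]

/-- `ψ` is an adjoint eigenfunction when every `D⁻¹ ψ L^{k/r}₊ + D⁻¹ ∂_k ψ` is differential. -/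
theorem isAdjointEigenfunction_iff {Q : PDO A} {ψ : A} : IsAdjointEigenfunction Q ψ ↔
    ∀ k : ℕ+, ∃ E, IsDiff E ∧
      fn ψ * plus (Q ^ (k : ℕ)) + fn (TimeAlgebra.d k ψ) = D 1 * E := by
  refine forall_congr' fun k => ?_
  rw [← plusAdjAct_plus]
  constructor
  · intro h
    obtain ⟨E, hE, h'⟩ := exists_fn_mul_eq (isDiff_plus (Q ^ (k : ℕ))) ψ
    refine ⟨E, hE, ?_⟩
    rw [h', h, fn_neg]
    abel
  · rintro ⟨E, hE, h⟩
    have h' : D (-1) * (fn ψ * plus (Q ^ (k : ℕ))) = E - D (-1) * fn (TimeAlgebra.d k ψ) := by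
      rw [← eq_sub_iff_add_eq] at h
      rw [h, mul_sub, ← mul_assoc, D_inv_mul_D, one_mul]
    rw [← coeff_neg_one_eq_plusAdjAct, h', coeff_sub, coeff_D_inv_mul_fn, hE _ (by omega)]
    ring

/-- D⁻¹ ψ B differs from the differential operator E by D⁻¹ ψ', which has order at most -1. So the
defining equations of a potential read ∂_k S = E(f). -/
theorem plusAct_potential {ψ ψ' : A} {B E : PDO A} (hE : IsDiff E)
    (h : fn ψ * B + fn ψ' = D 1 * E) (f : A) :
    plusAct (D (-1) * fn ψ * B) f = plusAct E f := by
  have : plus (D (-1) * fn ψ * B) = E := by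
    refine plus_eq_of_sub hE ?_
    rw [← eq_sub_iff_add_eq] at h
    rw [mul_assoc, h, mul_sub, ← mul_assoc, D_inv_mul_D, one_mul, sub_sub_cancel_left]
    exact (((ordLE_D (-1)).mul (ordLE_fn ψ')).mono (by omega)).neg
  rw [← plusAct_plus, this]

theorem IsPotential.dx_eq {Q : PDO A} (hQ : OrdLE (Q - D 1) (-1)) {f ψ S : A}
    (h : IsPotential Q f ψ S) : dx S = ψ * f := by
  have := h 1
  rw [plus_pow_one hQ, plusAct_potential (ψ' := dx ψ) (isDiff_fn ψ) (D_mul_fn ψ).symm,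
    plusAct_fn] at this
  exact this

/-- With the constant potential -1, the zero function is transformed into φ⁻¹. The new Ψ_c is thus
covered by the general transformation formula. -/
theorem isAdjointEigenfunction_zero (Q : PDO A) : IsAdjointEigenfunction Q 0 :=
  isAdjointEigenfunction_iff.mpr fun k => ⟨0, fun _ _ => rfl, by simp [fn_zero]⟩

theorem isPotential_zero (Q : PDO A) (f : A) {S : A} (hS : ∀ k : ℕ+, TimeAlgebra.d k S = 0) :
    IsPotential Q f 0 S := fun k => by
  rw [fn_zero, mul_zero, zero_mul, hS, ← fn_zero, plusAct_fn, zero_mul]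

end Eigenfunctions

/-! ### The Lax operator acting on eigenfunctions -/

section LaxAction

variable {r m : ℕ} {L Q : PDO A} {Φ Ψ : Fin m → A}

theorem IsCKP.root (h : IsCKP r L Q Φ Ψ) : OrdLE (Q - D 1) (-1) :=
  ordLE_sub_D_of_coeff h.root_top h.root_one h.root_zero

theorem ordLE_integral_part (Φ Ψ : Fin m → A) :
    OrdLE (∑ i, fn (Φ i) * D (-1) * fn (Ψ i)) (-1) :=
  OrdLE.sum fun i _ => (((ordLE_fn (Φ i)).mul (ordLE_D (-1))).mul (ordLE_fn (Ψ i))).mono (by omega)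

theorem IsCKP.exists_isDiff (h : IsCKP r L Q Φ Ψ) :
    ∃ B, IsDiff B ∧ L = B + ∑ i, fn (Φ i) * D (-1) * fn (Ψ i) := by
  obtain ⟨u, hu⟩ := h.form
  exact ⟨_, (isDiff_D (by omega)).add (IsDiff.sum fun j _ => isDiff_mono _ (by omega)), hu⟩

theorem plusAct_of_form {B : PDO A} (hB : IsDiff B)
    (h : L = B + ∑ i, fn (Φ i) * D (-1) * fn (Ψ i)) (f : A) : plusAct L f = plusAct B f := by
  rw [← plusAct_plus L, plus_eq_of_sub hB]
  rw [h, add_sub_cancel_left]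
  exact ordLE_integral_part Φ Ψ

/-- `L` maps eigenfunctions to eigenfunctions. -/
theorem IsCKP.isEigenfunction_action (h : IsCKP r L Q Φ Ψ) {f g : A} {S : Fin m → A}
    (hf : IsEigenfunction Q f) (hg : IsActionWith L Q Φ Ψ S f g) : IsEigenfunction Q g := by
  rw [isEigenfunction_iff] at hf ⊢
  intro k
  obtain ⟨P, hP, hL⟩ := h.exists_isDiff
  obtain ⟨hS, hg⟩ := hg
  have hΦ := fun i => isEigenfunction_iff.mp (h.eigen i) k
  choose E hE hE' using fun i => isAdjointEigenfunction_iff.mp (h.adjoint_eigen i) k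
  have hlax := h.lax k
  have hfk := hf k
  have hSk : ∀ i, TimeAlgebra.d k (S i) = plusAct (E i) f := fun i => by
    rw [hS i k, plusAct_potential (hE i) (hE' i)]
  have hSx := fun i => (hS i).dx_eq h.root
  set B := plus (Q ^ (k : ℕ)) with hBdef
  have hB : IsDiff B := isDiff_plus _
  choose G hG hG' using fun i => exists_mul_fn_eq hB (Φ i)
  rw [plusAct_of_form hP hL] at hg
  -- The differential part of the Lax equation. Commuting B with Φ_i D⁻¹ Ψ_i leaves the differential
  -- remainder G_i Ψ_i - Φ_i E_i, and the remaining terms are exactly the time derivative of Φ_i D⁻¹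
  -- Ψ_i.
  have key : dt k P = B * P - P * B + (∑ i, G i * fn (Ψ i) - ∑ i, fn (Φ i) * E i) := by
    have h1 : ∀ i, B * (fn (Φ i) * D (-1) * fn (Ψ i)) - fn (Φ i) * D (-1) * fn (Ψ i) * B
        = (G i * fn (Ψ i) - fn (Φ i) * E i)
          + (fn (TimeAlgebra.d k (Φ i)) * D (-1) * fn (Ψ i)
            + fn (Φ i) * D (-1) * fn (TimeAlgebra.d k (Ψ i))) := fun i => by
      have e1 : B * (fn (Φ i) * D (-1) * fn (Ψ i))
          = fn (TimeAlgebra.d k (Φ i)) * D (-1) * fn (Ψ i) + G i * fn (Ψ i) := by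
        rw [← mul_assoc, ← mul_assoc, hG', ← hΦ, add_mul, add_mul, mul_assoc (G i), D_mul_D_inv,
          mul_one]
      have e2 : fn (Φ i) * D (-1) * fn (Ψ i) * B
          = fn (Φ i) * E i - fn (Φ i) * D (-1) * fn (TimeAlgebra.d k (Ψ i)) := by
        rw [mul_assoc, eq_sub_of_add_eq (hE' i), mul_sub, mul_assoc (fn (Φ i)), ← mul_assoc (D (-1)),
          D_inv_mul_D, one_mul]
      rw [e1, e2]
      abel
    have h2 : ∀ i, dt k (fn (Φ i) * D (-1) * fn (Ψ i))
        = fn (TimeAlgebra.d k (Φ i)) * D (-1) * fn (Ψ i)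
            + fn (Φ i) * D (-1) * fn (TimeAlgebra.d k (Ψ i)) := fun i => by
      rw [dt_mul, dt_mul, dt_D, dt_fn, dt_fn, mul_zero, add_zero]
    rw [hL, dt_add, dt_sum, mul_add, add_mul, Finset.mul_sum, Finset.sum_mul] at hlax
    simp only [h2] at hlax
    have h3 : dt k P = B * P - P * B
        + ∑ i, (B * (fn (Φ i) * D (-1) * fn (Ψ i)) - fn (Φ i) * D (-1) * fn (Ψ i) * B)
        - ∑ i, (fn (TimeAlgebra.d k (Φ i)) * D (-1) * fn (Ψ i)
            + fn (Φ i) * D (-1) * fn (TimeAlgebra.d k (Ψ i))) := by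
      rw [Finset.sum_sub_distrib, eq_sub_iff_add_eq, hlax]
      abel
    rw [h3]
    simp only [h1]
    rw [Finset.sum_add_distrib, Finset.sum_sub_distrib]
    abel
  -- Since Ψ_i f = ∂S_i, this applies G_i D = B Φ_i - B(Φ_i) to S_i.
  have hGS : ∀ i, plusAct (G i) (Ψ i * f)
      = plusAct B (Φ i * S i) - TimeAlgebra.d k (Φ i) * S i := fun i => by
    rw [← hSx, ← plusAct_D, ← plusAct_mul (hG i) (isDiff_D zero_le_one), ← plusAct_mul_fn _ hB, hG',
      plusAct_add, plusAct_fn, ← hΦ]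
    ring
  rw [hg, map_add, d_plusAct k hP, hfk, key, map_sum, act_add, act_sum, plusAct_add, plusAct_sub,
    plusAct_sub, plusAct_mul hB hP, plusAct_mul hP hB, plusAct_sum, plusAct_sum]
  simp only [plusAct_mul_fn _ (hG _), hGS, plusAct_fn_mul _ (hE _), Derivation.leibniz, hSk,
    smul_eq_mul, Finset.sum_add_distrib, Finset.sum_sub_distrib]
  simp only [mul_comm (S _)]
  ring

end LaxAction

/-! ### The Darboux operator T = φ D φ⁻¹ -/

section Darboux

variable {φ : A}

theorem dbAct_eq_plusAct (φ f : A) : dbAct φ f = plusAct (dbOp φ) f := by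
  rw [dbAct, dbOp, plusAct_mul_fn _ ((isDiff_fn φ).mul (isDiff_D zero_le_one)),
    plusAct_fn_mul _ (isDiff_D zero_le_one), plusAct_D]

theorem isDiff_dbOp (φ : A) : IsDiff (dbOp φ) :=
  ((isDiff_fn φ).mul (isDiff_D zero_le_one)).mul (isDiff_fn _)

theorem dbAct_self (hφ : IsUnit φ) : dbAct φ φ = 0 := by
  rw [dbAct, Ring.inverse_mul_cancel _ hφ, Derivation.map_one_eq_zero, mul_zero]

theorem fn_mul_fn_inverse (hφ : IsUnit φ) : fn φ * fn (Ring.inverse φ) = 1 := by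
  rw [← fn_mul, Ring.mul_inverse_cancel _ hφ, fn_one]

theorem fn_inverse_mul_fn (hφ : IsUnit φ) : fn (Ring.inverse φ) * fn φ = 1 := by
  rw [← fn_mul, Ring.inverse_mul_cancel _ hφ, fn_one]

theorem dbOp_mul_inv (hφ : IsUnit φ) : dbOp φ * dbOpInv φ = 1 := by
  calc dbOp φ * dbOpInv φ
      = fn φ * D 1 * (fn (Ring.inverse φ) * fn φ) * D (-1) * fn (Ring.inverse φ) := by
        simp only [dbOp, dbOpInv, mul_assoc]
    _ = fn φ * (D 1 * D (-1)) * fn (Ring.inverse φ) := by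
        rw [fn_inverse_mul_fn hφ, mul_one, mul_assoc (fn φ)]
    _ = 1 := by rw [D_mul_D_inv, mul_one, fn_mul_fn_inverse hφ]

theorem inv_mul_dbOp (hφ : IsUnit φ) : dbOpInv φ * dbOp φ = 1 := by
  calc dbOpInv φ * dbOp φ
      = fn φ * D (-1) * (fn (Ring.inverse φ) * fn φ) * D 1 * fn (Ring.inverse φ) := by
        simp only [dbOp, dbOpInv, mul_assoc]
    _ = fn φ * (D (-1) * D 1) * fn (Ring.inverse φ) := by
        rw [fn_inverse_mul_fn hφ, mul_one, mul_assoc (fn φ)]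
    _ = 1 := by rw [D_inv_mul_D, mul_one, fn_mul_fn_inverse hφ]

theorem mul_dbOp_cancel (hφ : IsUnit φ) {P R : PDO A} (h : P * dbOp φ = R * dbOp φ) : P = R := by
  have := congrArg (fun X => X * dbOpInv φ) h
  simpa only [mul_assoc, dbOp_mul_inv hφ, mul_one] using this

theorem ordLE_dbOpInv (φ : A) : OrdLE (dbOpInv φ) (-1) :=
  (((ordLE_fn φ).mul (ordLE_D (-1))).mul (ordLE_fn _)).mono (by omega)

theorem ordLE_dbOp (φ : A) : OrdLE (dbOp φ) 1 :=
  (((ordLE_fn φ).mul (ordLE_D 1)).mul (ordLE_fn _)).mono (by omega)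

theorem dbOp_mul_fn (hφ : IsUnit φ) (h : A) :
    dbOp φ * fn h = fn (dbAct φ h) + fn h * D 1 := by
  rw [dbOp, mul_assoc, ← fn_mul, mul_assoc, D_mul_fn, mul_add, ← fn_mul, ← mul_assoc, ← fn_mul,
    ← mul_assoc, Ring.mul_inverse_cancel _ hφ, one_mul, add_comm]
  rfl

theorem dbOp_eq (hφ : IsUnit φ) : dbOp φ = D 1 + fn (dbAct φ 1) := by
  have := dbOp_mul_fn hφ 1
  rwa [fn_one, mul_one, one_mul, add_comm] at this

theorem dbAct_mul (hφ : IsUnit φ) (h s : A) : dbAct φ (h * s) = dbAct φ h * s + h * dx s := by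
  rw [dbAct, ← mul_assoc, Derivation.leibniz, dbAct, smul_eq_mul, smul_eq_mul, mul_add,
    ← mul_assoc, ← mul_assoc, Ring.mul_inverse_cancel _ hφ]
  ring

theorem dt_dbOp (hφ : IsUnit φ) (k : ℕ+) :
    dt k (dbOp φ) = fn (TimeAlgebra.d k (dbAct φ 1)) := by
  rw [dbOp_eq hφ, dt_add, dt_D, zero_add, dt_fn]

/-- A differential operator that kills `φ` is divisible by `T = φ D φ⁻¹`. -/
theorem isDiff_mul_dbOpInv {P : PDO A} (hP : IsDiff P) (h : plusAct P φ = 0) :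
    IsDiff (P * dbOpInv φ) := by
  obtain ⟨G, hG, hG'⟩ := exists_mul_fn_eq hP φ
  have : P * dbOpInv φ = G * fn (Ring.inverse φ) := by
    rw [dbOpInv, ← mul_assoc, ← mul_assoc, hG', h, fn_zero, zero_add, mul_assoc G, D_mul_D_inv,
      mul_one]
  rw [this]
  exact hG.mul (isDiff_fn _)

theorem conj_mul_dbOp (hφ : IsUnit φ) (P : PDO A) :
    dbOp φ * P * dbOpInv φ * dbOp φ = dbOp φ * P := by
  rw [mul_assoc _ (dbOpInv φ), inv_mul_dbOp hφ, mul_one]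

theorem dbOp_conj_pow (hφ : IsUnit φ) (Q : PDO A) (n : ℕ) :
    (dbOp φ * Q * dbOpInv φ) ^ n = dbOp φ * Q ^ n * dbOpInv φ := by
  induction n with
  | zero => rw [npow_zero_eq, npow_zero_eq, mul_one, dbOp_mul_inv hφ]
  | succ n ih =>
    apply mul_dbOp_cancel hφ
    rw [npow_succ_eq, npow_succ_eq, mul_assoc, conj_mul_dbOp hφ, conj_mul_dbOp hφ, ih, ← mul_assoc,
      conj_mul_dbOp hφ, mul_assoc]

/-- T = D + b with b = T(1), so T D T⁻¹ - D = [T, D] T⁻¹ = -(∂b) T⁻¹, which has order at most -1. -/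
theorem ordLE_conj_sub_D (hφ : IsUnit φ) {Q : PDO A} (hQ : OrdLE (Q - D 1) (-1)) :
    OrdLE (dbOp φ * Q * dbOpInv φ - D 1) (-1) := by
  have h : dbOp φ * Q * dbOpInv φ - D 1
      = dbOp φ * (Q - D 1) * dbOpInv φ - fn (dx (dbAct φ 1)) * dbOpInv φ := by
    apply mul_dbOp_cancel hφ
    rw [sub_mul, sub_mul, conj_mul_dbOp hφ, conj_mul_dbOp hφ, mul_assoc (fn _), inv_mul_dbOp hφ,
      mul_one, mul_sub, dbOp_eq hφ, mul_add, add_mul, add_mul, D_mul_fn]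
    abel
  rw [h]
  exact ((((ordLE_dbOp φ).mul hQ).mul (ordLE_dbOpInv φ)).mono (by omega)).sub
    (((ordLE_fn _).mul (ordLE_dbOpInv φ)).mono (by omega))

variable {Q : PDO A}

/-- The differential parts of the powers of `Q' = T Q T⁻¹`. -/
theorem plus_conj_pow_mul (hφ : IsUnit φ) (hφe : IsEigenfunction Q φ) (k : ℕ+) :
    plus ((dbOp φ * Q * dbOpInv φ) ^ (k : ℕ)) * dbOp φ
      = dbOp φ * plus (Q ^ (k : ℕ)) + dt k (dbOp φ) := by
  rw [isEigenfunction_iff] at hφe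
  set B := plus (Q ^ (k : ℕ)) with hB
  have hBd : IsDiff B := isDiff_plus _
  have hdiff : IsDiff ((dbOp φ * B + dt k (dbOp φ)) * dbOpInv φ) := by
    refine isDiff_mul_dbOpInv (((isDiff_dbOp φ).mul hBd).add ((isDiff_dbOp φ).dt k)) ?_
    -- Differentiating T(φ) = 0 in t_k gives (∂_k T + T B)(φ) = 0.
    have := d_plusAct k (isDiff_dbOp φ) φ
    rw [← dbAct_eq_plusAct, dbAct_self hφ, map_zero, hφe k] at this
    rw [plusAct_add, plusAct_mul (isDiff_dbOp φ) hBd, this, add_comm]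
  rw [plus_eq_of_sub hdiff, mul_assoc _ (dbOpInv φ), inv_mul_dbOp hφ, mul_one]
  have h : (dbOp φ * Q * dbOpInv φ) ^ (k : ℕ) - (dbOp φ * B + dt k (dbOp φ)) * dbOpInv φ
      = dbOp φ * minus (Q ^ (k : ℕ)) * dbOpInv φ - dt k (dbOp φ) * dbOpInv φ := by
    have h0 : B + minus (Q ^ (k : ℕ)) = Q ^ (k : ℕ) := plus_add_minus _
    rw [dbOp_conj_pow hφ, eq_sub_of_add_eq' h0]
    noncomm_ring
  rw [h, dt_dbOp hφ]
  exact ((((ordLE_dbOp φ).mul (ordLE_minus _)).mul (ordLE_dbOpInv φ)).mono (by omega)).sub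
    (((ordLE_fn _).mul (ordLE_dbOpInv φ)).mono (by omega))

theorem IsEigenfunction.dbAct (hφ : IsUnit φ) (hφe : IsEigenfunction Q φ) {f : A}
    (hf : IsEigenfunction Q f) : IsEigenfunction (dbOp φ * Q * dbOpInv φ) (dbAct φ f) := by
  rw [isEigenfunction_iff] at hf ⊢
  intro k
  rw [dbAct_eq_plusAct, d_plusAct k (isDiff_dbOp φ), hf k,
    ← plusAct_mul (isDiff_dbOp φ) (isDiff_plus _), ← plusAct_mul (isDiff_plus _) (isDiff_dbOp φ),
    plus_conj_pow_mul hφ hφe, plusAct_add, add_comm]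

/-- A gauge transformation: B' T = T B + ∂_k T says ∂_k - B' = T (∂_k - B) T⁻¹, and the Lax equation
says that ∂_k - B commutes with L. -/
theorem lax_conj (hφ : IsUnit φ) (hφe : IsEigenfunction Q φ) {L : PDO A} {k : ℕ+}
    (hL : dt k L = plus (Q ^ (k : ℕ)) * L - L * plus (Q ^ (k : ℕ))) :
    dt k (dbOp φ * L * dbOpInv φ)
      = plus ((dbOp φ * Q * dbOpInv φ) ^ (k : ℕ)) * (dbOp φ * L * dbOpInv φ)
        - dbOp φ * L * dbOpInv φ * plus ((dbOp φ * Q * dbOpInv φ) ^ (k : ℕ)) := by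
  have hB := plus_conj_pow_mul hφ hφe k
  have hLT := conj_mul_dbOp hφ L
  set B := plus (Q ^ (k : ℕ))
  set B' := plus ((dbOp φ * Q * dbOpInv φ) ^ (k : ℕ))
  set L' := dbOp φ * L * dbOpInv φ
  clear_value B B' L'
  apply mul_dbOp_cancel hφ
  have h1 : dt k L' * dbOp φ = dt k (dbOp φ * L) - L' * dt k (dbOp φ) := by
    rw [← hLT, dt_mul, add_sub_cancel_right]
  have h2 : dt k (dbOp φ) = B' * dbOp φ - dbOp φ * B := by rw [hB]; abel
  have h3 : L' * (dbOp φ * B) = dbOp φ * L * B := by rw [← mul_assoc, hLT]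
  rw [h1, dt_mul, hL, sub_mul, mul_assoc B', hLT, mul_assoc L', h2, mul_sub L', h3]
  noncomm_ring

/-! ### Adjoint eigenfunctions and potentials under T -/

section Adjoint

variable {ψ S : A}

theorem fn_mul_dbOp (hQ : OrdLE (Q - D 1) (-1)) (hφ : IsUnit φ) (hS : IsPotential Q φ ψ S) :
    fn (-(Ring.inverse φ * S)) * dbOp φ = D 1 * fn (-(Ring.inverse φ * S)) + fn ψ := by
  have h1 : fn (-(Ring.inverse φ * S)) * dbOp φ = -(fn S * D 1 * fn (Ring.inverse φ)) := by
    rw [dbOp, ← mul_assoc, ← mul_assoc, ← fn_mul,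
      show -(Ring.inverse φ * S) * φ = -(S * (Ring.inverse φ * φ)) by ring,
      Ring.inverse_mul_cancel _ hφ, mul_one, fn_neg, neg_mul, neg_mul]
  have h2 : fn S * D 1 = D 1 * fn S - fn (ψ * φ) := by
    rw [D_mul_fn, hS.dx_eq hQ, add_sub_cancel_right]
  rw [h1, h2, sub_mul, ← fn_mul, mul_assoc ψ, Ring.mul_inverse_cancel _ hφ, mul_one, fn_neg,
    mul_comm (Ring.inverse φ), fn_mul, mul_neg, mul_assoc]
  abel

/-- With χ = -φ⁻¹ S, the relation χ T = D χ + ψ differentiated in t_k gives (χ B' + ∂_k χ) T = D (E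
+ χ B + ∂_k χ). Dividing by T yields E'. The last equation also transports potentials: E'(T(f)) =
E(f) + ∂_k(χ f) for an eigenfunction f. -/
theorem exists_adjoint_factor (hQ : OrdLE (Q - D 1) (-1)) (hφ : IsUnit φ)
    (hφe : IsEigenfunction Q φ) (hψ : IsAdjointEigenfunction Q ψ) (hS : IsPotential Q φ ψ S)
    (k : ℕ+) : ∃ E E', IsDiff E ∧ IsDiff E' ∧
      fn ψ * plus (Q ^ (k : ℕ)) + fn (TimeAlgebra.d k ψ) = D 1 * E ∧
      fn (-(Ring.inverse φ * S)) * plus ((dbOp φ * Q * dbOpInv φ) ^ (k : ℕ))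
        + fn (TimeAlgebra.d k (-(Ring.inverse φ * S))) = D 1 * E' ∧
      E' * dbOp φ = E + fn (-(Ring.inverse φ * S)) * plus (Q ^ (k : ℕ))
        + fn (TimeAlgebra.d k (-(Ring.inverse φ * S))) := by
  obtain ⟨E, hE, hEeq⟩ := isAdjointEigenfunction_iff.mp hψ k
  have hT := fn_mul_dbOp hQ hφ hS
  have hB := plus_conj_pow_mul hφ hφe k
  have hSk : TimeAlgebra.d k S = plusAct E φ := by rw [hS k, plusAct_potential hE hEeq]
  have hφk := isEigenfunction_iff.mp hφe k
  have hχφ : -(Ring.inverse φ * S) * φ = -S := by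
    rw [show -(Ring.inverse φ * S) * φ = -(S * (Ring.inverse φ * φ)) by ring,
      Ring.inverse_mul_cancel _ hφ, mul_one]
  set χ := -(Ring.inverse φ * S)
  set B := plus (Q ^ (k : ℕ)) with hBdef
  have hBd : IsDiff B := isDiff_plus _
  clear_value χ
  refine ⟨E, (E + fn χ * B + fn (TimeAlgebra.d k χ)) * dbOpInv φ, hE, ?_, hEeq, ?_, ?_⟩
  · refine isDiff_mul_dbOpInv ((hE.add ((isDiff_fn χ).mul hBd)).add (isDiff_fn _)) ?_
    -- χ φ = -S and ∂_k S = E(φ), so the operator takes φ to ∂_k S + ∂_k(χ φ) = 0.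
    have := congrArg (TimeAlgebra.d k) hχφ
    rw [Derivation.leibniz, map_neg, smul_eq_mul, smul_eq_mul, hφk, hSk] at this
    rw [plusAct_add, plusAct_add, plusAct_fn, plusAct_fn_mul _ hBd]
    linear_combination this
  · apply mul_dbOp_cancel hφ
    have hd := congrArg (dt k) hT
    rw [dt_mul, dt_add, dt_mul, dt_D, dt_fn, dt_fn, zero_mul, zero_add] at hd
    rw [add_mul, mul_assoc, hB, mul_assoc (D 1), mul_assoc _ (dbOpInv φ), inv_mul_dbOp hφ, mul_one,
      mul_add, ← mul_assoc, hT, mul_add, mul_add, ← hEeq, add_mul]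
    rw [add_comm] at hd
    rw [add_assoc, hd]
    noncomm_ring
  · rw [mul_assoc, inv_mul_dbOp hφ, mul_one]

theorem IsAdjointEigenfunction.darboux (hQ : OrdLE (Q - D 1) (-1)) (hφ : IsUnit φ)
    (hφe : IsEigenfunction Q φ) (hψ : IsAdjointEigenfunction Q ψ) (hS : IsPotential Q φ ψ S) :
    IsAdjointEigenfunction (dbOp φ * Q * dbOpInv φ) (-(Ring.inverse φ * S)) :=
  isAdjointEigenfunction_iff.mpr fun k =>
    let ⟨_, E', _, hE', _, h, _⟩ := exists_adjoint_factor hQ hφ hφe hψ hS k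
    ⟨E', hE', h⟩

theorem IsPotential.darboux (hQ : OrdLE (Q - D 1) (-1)) (hφ : IsUnit φ)
    (hφe : IsEigenfunction Q φ) (hψ : IsAdjointEigenfunction Q ψ) (hS : IsPotential Q φ ψ S)
    {f R : A} (hf : IsEigenfunction Q f) (hR : IsPotential Q f ψ R) :
    IsPotential (dbOp φ * Q * dbOpInv φ) (dbAct φ f) (-(Ring.inverse φ * S))
      (R + -(Ring.inverse φ * S) * f) := by
  intro k
  obtain ⟨E, E', hE, hE', h, h', hEE⟩ := exists_adjoint_factor hQ hφ hφe hψ hS k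
  rw [plusAct_potential hE' h', dbAct_eq_plusAct, ← plusAct_mul hE' (isDiff_dbOp φ), hEE,
    plusAct_add, plusAct_add, plusAct_fn, plusAct_fn_mul _ (isDiff_plus _), map_add, hR k,
    plusAct_potential hE h, Derivation.leibniz, isEigenfunction_iff.mp hf k, smul_eq_mul,
    smul_eq_mul]
  ring

end Adjoint

end Darboux

end

noncomputable section

open PDO

variable {A : Type*} [CommRing A] [Algebra ℚ A] [TimeAlgebra A]

namespace PDO

/-- An operator `D^r + (order ≤ r - 2)` is determined by finitely many functions, up to its
integral part. -/
theorem exists_coeff_form {P : PDO A} (hP : IsDiff P) {r : ℕ}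
    (h : OrdLE (P - D (r : ℤ)) (r - 2)) :
    P = D (r : ℤ) + ∑ j ∈ Finset.range (r - 1), PDO.mono (P.coeff j) (j : ℤ) := by
  ext n
  rw [coeff_add, coeff_sum]
  simp only [coeff_mono]
  rcases lt_or_ge n 0 with hn | hn
  · rw [hP n hn, coeff_D, if_neg (by omega), Finset.sum_eq_zero, add_zero]
    intro j _
    rw [if_neg (by omega)]
  · lift n to ℕ using hn
    by_cases hnr : n < r - 1
    · rw [coeff_D, if_neg (by omega), zero_add, Finset.sum_eq_single_of_mem n (by simpa using hnr)]
      · simp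
      · intro j _ hj
        rw [if_neg (by omega)]
    · rw [coeff_of_ordLE_sub_D h (by omega), ← coeff_D, Finset.sum_eq_zero, add_zero]
      intro j hj
      rw [Finset.mem_range] at hj
      rw [if_neg (by omega)]

end PDO

/-! ### One Darboux–Bäcklund step -/

section Step

variable {r m : ℕ} {L Q : PDO A} {Φ Ψ : Fin m → A} {c : Fin m} {S : Fin m → A} {g : A}

/-- The eigenfunctions after the Darboux transformation with `Φ_c`, where `g = L(Φ_c)`. -/
def darbouxEigen (Φ : Fin m → A) (c : Fin m) (g : A) (i : Fin m) : A :=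
  dbAct (Φ c) (if i = c then g else Φ i)

/-- The adjoint eigenfunctions after the Darboux transformation with `Φ_c`, where
`S_i = ∂⁻¹(Ψ_i Φ_c)`. -/
def darbouxAdjoint (Φ : Fin m → A) (c : Fin m) (S : Fin m → A) (i : Fin m) : A :=
  if i = c then Ring.inverse (Φ c) else -(Ring.inverse (Φ c) * S i)

/-- The operator `T L₊ + ∑ Φ_i Ψ_i - ∑ Φ'_i Ψ'_i`, which is `L'₊ T`. -/
theorem exists_darboux_form (h : IsCKP r L Q Φ Ψ) (hφ : IsUnit (Φ c))
    (hg : IsActionWith L Q Φ Ψ S (Φ c) g) :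
    ∃ B', IsDiff B' ∧ dbOp (Φ c) * L * dbOpInv (Φ c) = B' +
        ∑ i, fn (darbouxEigen Φ c g i) * D (-1) * fn (darbouxAdjoint Φ c S i) ∧
      ∀ f, plusAct B' (dbAct (Φ c) f) = dbAct (Φ c) (plusAct L f) + ∑ i, Φ i * Ψ i * f
        - ∑ i, darbouxEigen Φ c g i * darbouxAdjoint Φ c S i * f := by
  obtain ⟨B, hB, hL⟩ := h.exists_isDiff
  obtain ⟨hS, hg⟩ := hg
  have hSx := fun i => (hS i).dx_eq h.root
  set P := dbOp (Φ c) * B + (∑ i, fn (Φ i * Ψ i)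
    - ∑ i, fn (darbouxEigen Φ c g i * darbouxAdjoint Φ c S i)) with hP
  have hPd : IsDiff P := ((isDiff_dbOp _).mul hB).add
    ((IsDiff.sum fun i _ => isDiff_fn _).sub (IsDiff.sum fun i _ => isDiff_fn _))
  have hPact : ∀ f, plusAct P f = dbAct (Φ c) (plusAct L f) + ∑ i, Φ i * Ψ i * f
        - ∑ i, darbouxEigen Φ c g i * darbouxAdjoint Φ c S i * f := fun f => by
    rw [hP, plusAct_add, plusAct_sub, plusAct_sum, plusAct_sum, plusAct_mul (isDiff_dbOp _) hB,
      ← dbAct_eq_plusAct, plusAct_of_form hB hL]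
    simp only [plusAct_fn]
    ring
  have hterm : ∀ i, darbouxEigen Φ c g i * darbouxAdjoint Φ c S i * Φ c
      = (if i = c then dbAct (Φ c) g else 0) - dbAct (Φ c) (Φ i) * S i := fun i => by
    unfold darbouxEigen darbouxAdjoint
    split_ifs with hi
    · rw [hi, dbAct_self hφ, zero_mul, sub_zero, mul_assoc, Ring.inverse_mul_cancel _ hφ, mul_one]
    · linear_combination (-dbAct (Φ c) (Φ i) * S i) * Ring.inverse_mul_cancel _ hφ
  -- Expanding T(g) = T(L₊(φ)) + ∑ T(Φ_i S_i) by the product rule with ∂S_i = Ψ_i φ matches the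
  -- remaining terms, because Ψ'_i φ = -S_i for i ≠ c and Ψ'_c φ = 1.
  have hPφ : plusAct P (Φ c) = 0 := by
    rw [hPact, sub_eq_zero]
    simp only [hterm]
    rw [Finset.sum_sub_distrib, Finset.sum_ite_eq', if_pos (Finset.mem_univ c), hg,
      dbAct_eq_plusAct _ (_ + _), act_add, act_sum]
    simp only [← dbAct_eq_plusAct, dbAct_mul hφ, hSx, Finset.sum_add_distrib, mul_assoc]
    ring
  refine ⟨P * dbOpInv (Φ c), isDiff_mul_dbOpInv hPd hPφ, ?_, fun f => ?_⟩
  · apply mul_dbOp_cancel hφ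
    -- Multiplied by T on the right, both integral parts produce T(Φ_i) D⁻¹ Ψ_i for i ≠ c. At i = c
    -- this term is zero, since T(Φ_c) = 0.
    have hΨT : ∀ i, i ≠ c → fn (darbouxAdjoint Φ c S i) * dbOp (Φ c)
        = D 1 * fn (darbouxAdjoint Φ c S i) + fn (Ψ i) := fun i hi => by
      rw [darbouxAdjoint, if_neg hi, fn_mul_dbOp h.root hφ (hS i)]
    have hΨc : fn (darbouxAdjoint Φ c S c) * dbOp (Φ c)
        = D 1 * fn (darbouxAdjoint Φ c S c) := by
      rw [darbouxAdjoint, if_pos rfl, dbOp, ← mul_assoc, ← mul_assoc, fn_inverse_mul_fn hφ, one_mul]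
    have h1 : ∀ i, dbOp (Φ c) * (fn (Φ i) * D (-1) * fn (Ψ i))
        = fn (dbAct (Φ c) (Φ i)) * D (-1) * fn (Ψ i) + fn (Φ i * Ψ i) := fun i => by
      rw [← mul_assoc, ← mul_assoc, dbOp_mul_fn hφ, add_mul, add_mul, mul_assoc (fn (Φ i)),
        D_mul_D_inv, mul_one, fn_mul]
    have h2 : ∀ i, fn (darbouxEigen Φ c g i) * D (-1) * fn (darbouxAdjoint Φ c S i) * dbOp (Φ c)
        = fn (darbouxEigen Φ c g i * darbouxAdjoint Φ c S i)
          + fn (dbAct (Φ c) (Φ i)) * D (-1) * fn (Ψ i) := fun i => by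
      by_cases hi : i = c
      · subst hi
        rw [mul_assoc, hΨc, dbAct_self hφ, fn_zero, zero_mul, zero_mul, add_zero, mul_assoc,
          ← mul_assoc (D (-1)), D_inv_mul_D, one_mul, fn_mul]
      · rw [mul_assoc, hΨT i hi, mul_add, mul_assoc, ← mul_assoc (D (-1)), D_inv_mul_D, one_mul,
          fn_mul, darbouxEigen, if_neg hi]
    rw [conj_mul_dbOp hφ, add_mul, mul_assoc P, inv_mul_dbOp hφ, mul_one, Finset.sum_mul]
    simp only [h2]
    rw [hL, mul_add, Finset.mul_sum]
    simp only [h1]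
    rw [hP, Finset.sum_add_distrib, Finset.sum_add_distrib]
    abel
  · rw [dbAct_eq_plusAct, ← plusAct_mul (isDiff_mul_dbOpInv hPd hPφ) (isDiff_dbOp _), mul_assoc,
      inv_mul_dbOp hφ, mul_one, hPact]

/-- The Darboux–Bäcklund transformation of a constrained KP Lax operator. -/
theorem IsCKP.darboux (h : IsCKP r L Q Φ Ψ) (hφ : IsUnit (Φ c))
    (hg : IsActionWith L Q Φ Ψ S (Φ c) g) :
    IsCKP r (dbOp (Φ c) * L * dbOpInv (Φ c)) (dbOp (Φ c) * Q * dbOpInv (Φ c))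
      (darbouxEigen Φ c g) (darbouxAdjoint Φ c S) := by
  have hroot := ordLE_conj_sub_D hφ h.root
  have hpow : (dbOp (Φ c) * Q * dbOpInv (Φ c)) ^ r = dbOp (Φ c) * L * dbOpInv (Φ c) := by
    rw [dbOp_conj_pow hφ, h.root_pow]
  refine ⟨fun j hj => ?_, ?_, ?_, hpow, ?_, fun k => lax_conj hφ (h.eigen c) (h.lax k),
    fun i => ?_, fun i => ?_⟩
  · rw [coeff_of_ordLE_sub_D hroot (by omega), if_neg hj.ne']
  · rw [coeff_of_ordLE_sub_D hroot (by omega), if_pos rfl]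
  · rw [coeff_of_ordLE_sub_D hroot (by omega), if_neg (by omega)]
  · obtain ⟨B', hB', hL', -⟩ := exists_darboux_form h hφ hg
    refine ⟨fun j => B'.coeff j, ?_⟩
    rw [hL']
    congr 1
    have hI := ordLE_integral_part (darbouxEigen Φ c g) (darbouxAdjoint Φ c S)
    have hord := ordLE_pow_sub_D hroot r
    rw [hpow, hL'] at hord
    -- The D^(r-1) term is absent because L' is the r-th power of a root D + O(D⁻¹); the integral
    -- part only affects negative orders.
    refine exists_coeff_form hB' fun j hj => ?_
    rcases lt_or_ge j 0 with hj0 | hj0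
    · rw [coeff_sub, hB' j hj0, coeff_D, if_neg (by omega), sub_zero]
    · have := hord j hj
      rwa [coeff_sub, coeff_add, hI j (by omega), add_zero, ← coeff_sub] at this
  · rw [darbouxEigen]
    split_ifs
    · exact (h.eigen c).dbAct hφ (h.isEigenfunction_action (h.eigen c) hg)
    · exact (h.eigen c).dbAct hφ (h.eigen i)
  · rw [darbouxAdjoint]
    split_ifs
    -- φ⁻¹ = -(φ⁻¹ · (-1)) is the transform of ψ = 0 with potential -1.
    · have := (isAdjointEigenfunction_zero Q).darboux (S := -1) h.root hφ (h.eigen c)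
        (isPotential_zero Q _ fun k => by rw [map_neg, Derivation.map_one_eq_zero, neg_zero])
      simpa using this
    · exact (h.adjoint_eigen i).darboux h.root hφ (h.eigen c) (hg.1 i)

/-- The action of Lax operators on eigenfunctions is compatible with `L' T = T L`. -/
theorem IsActionWith.darboux (h : IsCKP r L Q Φ Ψ) (hφ : IsUnit (Φ c))
    (hg : IsActionWith L Q Φ Ψ S (Φ c) g) {f f' : A} {R : Fin m → A}
    (hf : IsEigenfunction Q f) (hf' : IsActionWith L Q Φ Ψ R f f') :
    IsActionWith (dbOp (Φ c) * L * dbOpInv (Φ c)) (dbOp (Φ c) * Q * dbOpInv (Φ c))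
      (darbouxEigen Φ c g) (darbouxAdjoint Φ c S)
      (fun i => (if i = c then 0 else R i) + darbouxAdjoint Φ c S i * f)
      (dbAct (Φ c) f) (dbAct (Φ c) f') := by
  refine ⟨fun i => ?_, ?_⟩
  · by_cases hi : i = c
    · have := IsPotential.darboux (S := -1) (R := 0) h.root hφ (h.eigen c)
        (isAdjointEigenfunction_zero Q)
        (isPotential_zero Q _ fun k => by rw [map_neg, Derivation.map_one_eq_zero, neg_zero])
        hf (isPotential_zero Q _ fun k => map_zero _)
      simpa [darbouxAdjoint, hi] using this
    · simpa only [darbouxAdjoint, if_neg hi] using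
        (hg.1 i).darboux h.root hφ (h.eigen c) (h.adjoint_eigen i) hf (hf'.1 i)
  · obtain ⟨B', hB', hL', hact⟩ := exists_darboux_form h hφ hg
    have hterm : ∀ i, darbouxEigen Φ c g i *
        ((if i = c then 0 else R i) + darbouxAdjoint Φ c S i * f)
        = dbAct (Φ c) (Φ i) * R i + darbouxEigen Φ c g i * darbouxAdjoint Φ c S i * f := fun i => by
      by_cases hi : i = c
      · subst hi
        rw [if_pos rfl, dbAct_self hφ]
        ring
      · rw [if_neg hi, darbouxEigen, if_neg hi]
        ring
    have hRx := fun i => (hf'.1 i).dx_eq h.root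
    rw [plusAct_of_form hB' hL', hact, hf'.2]
    simp only [hterm]
    rw [dbAct_eq_plusAct _ (_ + _), act_add, act_sum]
    simp only [← dbAct_eq_plusAct, dbAct_mul hφ, hRx, Finset.sum_add_distrib, mul_assoc]
    ring

end Step

/-! ### Iterating along the orbit -/

section Orbit

variable {r m : ℕ} {L Q : PDO A} {Φ Ψ : Fin m → A} {χ : ℕ → Fin m → A}

theorem IsCKP.isEigenfunction_iterate (h : IsCKP r L Q Φ Ψ) (hχ0 : χ 0 = Φ)
    (hχ : ∀ s i, ∃ S, IsActionWith L Q Φ Ψ S (χ s i) (χ (s + 1) i)) (s : ℕ) (i : Fin m) :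
    IsEigenfunction Q (χ s i) := by
  induction s with
  | zero => rw [hχ0]; exact h.eigen i
  | succ s ih => exact h.isEigenfunction_action ih (hχ s i).choose_spec

theorem orbitFn_succ [NeZero m] (χ : ℕ → Fin m → A) (n s : ℕ) (i : Fin m) :
    orbitFn χ (n + 1) s i
      = dbAct (stepFn χ n) (orbitFn χ n (if i = stepIdx m n then s + 1 else s) i) := rfl

/-- The adjoint eigenfunctions along the orbit. -/
theorem exists_orbit_adjoint [NeZero m] (h0 : IsCKP r L Q Φ Ψ) (hχ0 : χ 0 = Φ)
    (hχ : ∀ s i, ∃ S, IsActionWith L Q Φ Ψ S (χ s i) (χ (s + 1) i))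
    (N : ℕ) (hunit : ∀ n < N, IsUnit (stepFn χ n)) :
    ∃ Θ : ℕ → Fin m → A, Θ 0 = Ψ ∧
      (∀ n ≤ N, IsCKP r (orbitOp χ L n) (orbitOp χ Q n) (orbitEigen χ n) (Θ n) ∧
        ∀ s i, ∃ S, IsActionWith (orbitOp χ L n) (orbitOp χ Q n) (orbitEigen χ n) (Θ n) S
          (orbitFn χ n s i) (orbitFn χ n (s + 1) i)) ∧
      ∀ n < N, ∃ S : Fin m → A,
        IsActionWith (orbitOp χ L n) (orbitOp χ Q n) (orbitEigen χ n) (Θ n) S (stepFn χ n)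
          (orbitFn χ n 1 (stepIdx m n)) ∧
        Θ (n + 1) = darbouxAdjoint (orbitEigen χ n) (stepIdx m n) S := by
  induction N with
  | zero =>
    refine ⟨fun _ => Ψ, rfl, fun n hn => ?_, fun n hn => absurd hn (Nat.not_lt_zero n)⟩
    obtain rfl : n = 0 := by omega
    have : orbitEigen χ 0 = Φ := hχ0
    rw [this]
    exact ⟨h0, hχ⟩
  | succ N ih =>
    obtain ⟨Θ, hΘ0, hΘ, hstep⟩ := ih fun n hn => hunit n (by omega)
    obtain ⟨hN, hNχ⟩ := hΘ N le_rfl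
    have hφ := hunit N (by omega)
    -- These primitives realise the value of L^{(N)}(Φ_c) already prescribed by the χ's. Using the
    -- same ones in the new adjoint eigenfunctions keeps the integration constants consistent.
    obtain ⟨S, hS⟩ := hNχ 0 (stepIdx m N)
    have heig : orbitEigen χ (N + 1)
        = darbouxEigen (orbitEigen χ N) (stepIdx m N) (orbitFn χ N 1 (stepIdx m N)) := by
      funext i
      change dbAct _ (orbitFn χ N (if i = stepIdx m N then 0 + 1 else 0) i) = dbAct _ _
      by_cases hi : i = stepIdx m N
      · subst hi
        simp only [if_true]
        rfl
      · simp only [hi, if_false]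
        rfl
    refine ⟨fun n => if n = N + 1 then darbouxAdjoint (orbitEigen χ N) (stepIdx m N) S else Θ n,
      by simpa using hΘ0, fun n hn => ?_, fun n hn => ?_⟩
    · rcases Nat.lt_or_ge N n with h | h
      · obtain rfl : n = N + 1 := by omega
        simp only [if_true]
        rw [heig]
        refine ⟨hN.darboux hφ hS, fun s i => ?_⟩
        have hχe := hN.isEigenfunction_iterate rfl hNχ
        by_cases hi : i = stepIdx m N
        · obtain ⟨R, hR⟩ := hNχ (s + 1) i
          have := IsActionWith.darboux hN hφ hS (hχe (s + 1) i) hR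
          have e : ∀ s, orbitFn χ (N + 1) s i = dbAct (stepFn χ N) (orbitFn χ N (s + 1) i) :=
            fun s => by rw [orbitFn_succ, if_pos hi]
          rw [e, e]
          exact ⟨_, this⟩
        · obtain ⟨R, hR⟩ := hNχ s i
          have := IsActionWith.darboux hN hφ hS (hχe s i) hR
          have e : ∀ s, orbitFn χ (N + 1) s i = dbAct (stepFn χ N) (orbitFn χ N s i) :=
            fun s => by rw [orbitFn_succ, if_neg hi]
          rw [e, e]
          exact ⟨_, this⟩
      · simp only [show n ≠ N + 1 by omega, if_false]
        exact hΘ n h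
    · rcases Nat.lt_or_ge n N with h | h
      · simp only [show n ≠ N + 1 by omega, show n + 1 ≠ N + 1 by omega, if_false]
        exact hstep n h
      · obtain rfl : n = N := by omega
        refine ⟨S, ?_, by simp⟩
        simp only [show n ≠ n + 1 by omega, if_false]
        exact hS

end Orbit

end

noncomputable section

open PDO
open Finset.HasAntidiagonal (antidiagonal mem_antidiagonal)

/-! ### The Euler operator on power series -/

section EulerOperator

variable {R : Type*} [Ring R]

/-- The Euler operator `λ d/dλ` on power series. -/
def eulerOp (F : PowerSeries R) : PowerSeries R :=
  PowerSeries.mk fun n => (n : R) * PowerSeries.coeff n F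

theorem eulerOp_mul (F G : PowerSeries R) : eulerOp (F * G) = eulerOp F * G + F * eulerOp G := by
  ext n
  simp only [eulerOp, PowerSeries.coeff_mk, map_add, PowerSeries.coeff_mul, Finset.mul_sum,
    ← Finset.sum_add_distrib]
  refine Finset.sum_congr rfl fun p hp => ?_
  rw [← mem_antidiagonal.mp hp, Nat.cast_add, add_mul, mul_assoc, ← mul_assoc _ (p.2 : R),
    (Nat.cast_commute p.2 (PowerSeries.coeff p.1 F)).eq.symm, mul_assoc]

/-- The coefficients need not commute, so the power rule requires F to commute with its Euler
derivative. For the shift exponent this follows from the commuting times. -/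
theorem eulerOp_pow_succ {F : PowerSeries R} (h : eulerOp F * F = F * eulerOp F) (k : ℕ) :
    eulerOp (F ^ (k + 1)) = (k + 1) • (eulerOp F * F ^ k) := by
  induction k with
  | zero => simp
  | succ k ih =>
    rw [pow_succ, eulerOp_mul, ih, smul_mul_assoc, mul_assoc, ← pow_succ,
      ((show Commute (eulerOp F) F from h).pow_right (k + 1)).eq.symm, ← succ_nsmul]

theorem coeff_pow_of_lt {R : Type*} [Semiring R] {F : PowerSeries R}
    (hF : PowerSeries.coeff 0 F = 0) {n k : ℕ} (h : n < k) : PowerSeries.coeff n (F ^ k) = 0 := by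
  induction k generalizing n with
  | zero => omega
  | succ k ih =>
    rw [pow_succ', PowerSeries.coeff_mul]
    refine Finset.sum_eq_zero fun p hp => ?_
    have hp' := mem_antidiagonal.mp hp
    rcases Nat.eq_zero_or_pos p.1 with h0 | h0
    · rw [h0, hF, zero_mul]
    · rw [ih (by omega), mul_zero]

end EulerOperator

variable {A : Type*} [CommRing A] [Algebra ℚ A] [TimeAlgebra A]

/-! ### The Miwa shift f(t - [λ]) -/

section Schur

theorem coeff_shiftExponent_zero : PowerSeries.coeff 0 (shiftExponent A) = 0 := by
  simp [shiftExponent]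

theorem coeff_shiftExponent_succ (n : ℕ) : PowerSeries.coeff (n + 1) (shiftExponent A)
    = (-(1 / ((n + 1 : ℕ) : ℚ))) •
      (TimeAlgebra.d (A := A) n.succPNat : Module.End ℚ A) := by
  simp only [shiftExponent, PowerSeries.coeff_mk, Nat.succ_pos, dif_pos]
  rfl

theorem coeff_shiftExponent_comm (i j : ℕ) :
    PowerSeries.coeff i (shiftExponent A) * PowerSeries.coeff j (shiftExponent A)
      = PowerSeries.coeff j (shiftExponent A) * PowerSeries.coeff i (shiftExponent A) := by
  rcases i with _ | i
  · rw [coeff_shiftExponent_zero, zero_mul, mul_zero]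
  rcases j with _ | j
  · rw [coeff_shiftExponent_zero, zero_mul, mul_zero]
  rw [coeff_shiftExponent_succ, coeff_shiftExponent_succ]
  ext f
  simp only [Module.End.mul_apply, LinearMap.smul_apply, map_smul]
  rw [smul_comm]
  congr 2
  exact TimeAlgebra.d_comm _ _ f

theorem eulerOp_shiftExponent_comm :
    eulerOp (shiftExponent A) * shiftExponent A = shiftExponent A * eulerOp (shiftExponent A) := by
  ext1 n
  rw [PowerSeries.coeff_mul, PowerSeries.coeff_mul, ← Finset.Nat.sum_antidiagonal_swap]
  refine Finset.sum_congr rfl fun p _ => ?_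
  simp only [eulerOp, PowerSeries.coeff_mk, Prod.fst_swap, Prod.snd_swap]
  rw [mul_assoc, coeff_shiftExponent_comm, ← mul_assoc, ← mul_assoc, (Nat.cast_commute _ _).eq]

theorem schurShift_zero (f : A) : schurShift 0 f = f := by
  simp [schurShift]

theorem schurShift_eq_sum {n K : ℕ} (h : n < K) : schurShift (A := A) n =
    ∑ k ∈ Finset.range K, (1 / (k.factorial : ℚ)) • PowerSeries.coeff n (shiftExponent A ^ k) := by
  refine Finset.sum_subset (fun k hk => ?_) fun k _ hk => ?_
  · rw [Finset.mem_range] at hk ⊢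
    omega
  · rw [Finset.mem_range] at hk
    have hnk : n < k := by omega
    rw [coeff_pow_of_lt (F := shiftExponent A) coeff_shiftExponent_zero hnk, smul_zero]

/-- The recursion `(n + 1) p_{n+1}(-[∂]) = -∑_{a+b=n} ∂_{a+1} p_b(-[∂])`. -/
theorem schurShift_succ (n : ℕ) (f : A) : ((n + 1 : ℕ) : A) * schurShift (n + 1) f
    = -∑ p ∈ antidiagonal n, TimeAlgebra.d p.1.succPNat (schurShift p.2 f) := by
  have key : ((n + 1 : ℕ) : Module.End ℚ A) * schurShift (n + 1)
      = ∑ p ∈ antidiagonal n,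
        (-(TimeAlgebra.d (A := A) p.1.succPNat : Module.End ℚ A)) * schurShift p.2 := by
    have h1 : ∀ k, ((n + 1 : ℕ) : Module.End ℚ A) *
        PowerSeries.coeff (n + 1) (shiftExponent A ^ (k + 1))
        = (k + 1) • ∑ p ∈ antidiagonal n,
          (-(TimeAlgebra.d (A := A) p.1.succPNat : Module.End ℚ A)) *
            PowerSeries.coeff p.2 (shiftExponent A ^ k) := fun k => by
      have := congrArg (PowerSeries.coeff (n + 1))
        (eulerOp_pow_succ (eulerOp_shiftExponent_comm (A := A)) k)
      rw [map_nsmul, PowerSeries.coeff_mul, Finset.Nat.sum_antidiagonal_succ] at this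
      simp only [eulerOp, PowerSeries.coeff_mk, coeff_shiftExponent_zero, mul_zero, zero_mul,
        zero_add] at this
      rw [this]
      congr 1
      refine Finset.sum_congr rfl fun p _ => ?_
      rw [coeff_shiftExponent_succ]
      congr 1
      rw [← nsmul_eq_mul, ← Nat.cast_smul_eq_nsmul ℚ, smul_smul]
      have : ((p.1 + 1 : ℕ) : ℚ) ≠ 0 := by positivity
      rw [mul_neg, mul_one_div_cancel this, neg_one_smul]
    have h2 : ∀ p ∈ antidiagonal n,
        (-(TimeAlgebra.d (A := A) p.1.succPNat : Module.End ℚ A)) * schurShift p.2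
        = ∑ k ∈ Finset.range (n + 1), (1 / (k.factorial : ℚ)) •
          ((-(TimeAlgebra.d (A := A) p.1.succPNat : Module.End ℚ A)) *
            PowerSeries.coeff p.2 (shiftExponent A ^ k)) := fun p hp => by
      have := mem_antidiagonal.mp hp
      rw [schurShift_eq_sum (K := n + 1) (by omega), Finset.mul_sum]
      exact Finset.sum_congr rfl fun k _ => mul_smul_comm _ _ _
    rw [Finset.sum_congr rfl h2, Finset.sum_comm, schurShift, Finset.sum_range_succ', mul_add,
      Finset.mul_sum]
    rw [pow_zero, PowerSeries.coeff_one, if_neg (by omega), smul_zero, mul_zero, add_zero]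
    refine Finset.sum_congr rfl fun k _ => ?_
    -- This is λ d/dλ exp F = (λ dF/dλ) exp F, term by term: (k + 1)/(k + 1)! = 1/k!.
    rw [mul_smul_comm, h1, ← Finset.smul_sum, ← Nat.cast_smul_eq_nsmul ℚ, smul_smul]
    congr 1
    rw [Nat.factorial_succ]
    have h3 : (k.factorial : ℚ) ≠ 0 := by positivity
    have h4 : ((k + 1 : ℕ) : ℚ) ≠ 0 := by positivity
    rw [Nat.cast_mul]
    field_simp
  have := LinearMap.congr_fun key f
  rw [← nsmul_eq_mul, LinearMap.smul_apply, nsmul_eq_mul, LinearMap.sum_apply] at this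
  rw [this, ← Finset.sum_neg_distrib]
  rfl

theorem natCast_succ_mul_cancel {A : Type*} [CommRing A] [Algebra ℚ A] {n : ℕ} {a b : A}
    (h : ((n + 1 : ℕ) : A) * a = ((n + 1 : ℕ) : A) * b) : a = b := by
  have hu : algebraMap ℚ A (1 / ((n + 1 : ℕ) : ℚ)) * ((n + 1 : ℕ) : A) = 1 := by
    rw [← map_natCast (algebraMap ℚ A), ← map_mul, one_div_mul_cancel (by positivity), map_one]
  rw [← one_mul a, ← one_mul b, ← hu, mul_assoc, h, mul_assoc]

theorem schurShift_one (f : A) : schurShift 1 f = -dx f := by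
  have := schurShift_succ 0 f
  simpa [schurShift_zero, dx, show Nat.succPNat 0 = 1 from rfl] using this

theorem schurShift_dx (n : ℕ) (f : A) : schurShift n (dx f) = dx (schurShift n f) := by
  induction n using Nat.strong_induction_on with
  | _ n ih =>
    rcases n with _ | n
    · rw [schurShift_zero, schurShift_zero]
    · apply natCast_succ_mul_cancel (n := n)
      have h : ((n + 1 : ℕ) : A) * dx (schurShift (n + 1) f)
          = dx (((n + 1 : ℕ) : A) * schurShift (n + 1) f) := by
        rw [Derivation.leibniz, Derivation.map_natCast, smul_zero, add_zero, smul_eq_mul]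
      rw [h, schurShift_succ, schurShift_succ, map_neg, map_sum]
      congr 1
      refine Finset.sum_congr rfl fun p hp => ?_
      have := mem_antidiagonal.mp hp
      rw [ih p.2 (by omega), dx, TimeAlgebra.d_comm]

theorem schurShift_succ_one (n : ℕ) : schurShift (n + 1) (1 : A) = 0 := by
  induction n using Nat.strong_induction_on with
  | _ n ih =>
    apply natCast_succ_mul_cancel (n := n)
    rw [schurShift_succ, mul_zero, neg_eq_zero]
    refine Finset.sum_eq_zero fun p hp => ?_
    have := mem_antidiagonal.mp hp
    rcases h : p.2 with _ | b
    · rw [schurShift_zero, Derivation.map_one_eq_zero]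
    · rw [ih b (by omega), map_zero]

/-- The operator `∑_a λ^a ∂_{a+1}` on power series. -/
def timeSeries (F : PowerSeries A) : PowerSeries A :=
  PowerSeries.mk fun n =>
    ∑ p ∈ antidiagonal n, TimeAlgebra.d p.1.succPNat (PowerSeries.coeff p.2 F)

/-- Coefficientwise differentiation of power series. -/
def seriesDeriv (k : ℕ+) (F : PowerSeries A) : PowerSeries A :=
  PowerSeries.mk fun n => TimeAlgebra.d k (PowerSeries.coeff n F)

theorem seriesDeriv_mul (k : ℕ+) (F G : PowerSeries A) :
    seriesDeriv k (F * G) = seriesDeriv k F * G + F * seriesDeriv k G := by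
  ext n
  simp only [seriesDeriv, PowerSeries.coeff_mk, map_add, PowerSeries.coeff_mul, map_sum,
    ← Finset.sum_add_distrib, Derivation.leibniz, smul_eq_mul]
  exact Finset.sum_congr rfl fun p _ => by ring

theorem coeff_timeSeries {n K : ℕ} (h : n < K) (F : PowerSeries A) :
    PowerSeries.coeff n (timeSeries F) = PowerSeries.coeff n
      (∑ a ∈ Finset.range K, PowerSeries.X ^ a * seriesDeriv a.succPNat F) := by
  rw [map_sum, timeSeries, PowerSeries.coeff_mk, Finset.Nat.sum_antidiagonal_eq_sum_range_succ_mk]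
  simp only [PowerSeries.coeff_X_pow_mul', seriesDeriv, PowerSeries.coeff_mk]
  rw [← Finset.sum_filter]
  refine Finset.sum_congr ?_ fun _ _ => rfl
  ext a
  simp only [Finset.mem_range, Finset.mem_filter]
  omega

/-- Modulo λ^(n+1) the operator is a finite sum of derivations multiplied by powers of λ, so the
Leibniz rule holds coefficient by coefficient. -/
theorem timeSeries_mul (F G : PowerSeries A) :
    timeSeries (F * G) = timeSeries F * G + F * timeSeries G := by
  have trunc : ∀ (n : ℕ) (F G : PowerSeries A), PowerSeries.coeff n (timeSeries F * G)
      = PowerSeries.coeff n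
        ((∑ a ∈ Finset.range (n + 1), PowerSeries.X ^ a * seriesDeriv a.succPNat F) * G) := by
    intro n F G
    rw [PowerSeries.coeff_mul, PowerSeries.coeff_mul]
    refine Finset.sum_congr rfl fun p hp => ?_
    have := mem_antidiagonal.mp hp
    rw [coeff_timeSeries (K := n + 1) (by omega)]
  ext n
  rw [map_add, mul_comm F (timeSeries G), trunc, trunc, coeff_timeSeries (Nat.lt_succ_self n),
    ← map_add, Finset.sum_mul, Finset.sum_mul, ← Finset.sum_add_distrib]
  congr 1
  refine Finset.sum_congr rfl fun a _ => ?_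
  rw [seriesDeriv_mul]
  ring

/-- `f(t - [λ]) = ∑_n λ^n p_n(-[∂]) f`. -/
def miwaSeries (f : A) : PowerSeries A := PowerSeries.mk fun n => schurShift n f

theorem derivative_miwaSeries (f : A) :
    PowerSeries.derivative A (miwaSeries f) = -timeSeries (miwaSeries f) := by
  ext n
  rw [PowerSeries.coeff_derivative, map_neg, timeSeries, PowerSeries.coeff_mk]
  simp only [miwaSeries, PowerSeries.coeff_mk]
  rw [← schurShift_succ, mul_comm]
  push_cast
  rfl

/-- The equation expresses (n + 1) F_{n+1} through F_0, …, F_n. Multiplicativity of the shift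
follows, as f(t - [λ]) g(t - [λ]) solves the same equation. -/
theorem powerSeries_ext_of_derivative {F G : PowerSeries A}
    (hF : PowerSeries.derivative A F = -timeSeries F)
    (hG : PowerSeries.derivative A G = -timeSeries G)
    (h0 : PowerSeries.coeff 0 F = PowerSeries.coeff 0 G) : F = G := by
  ext n
  induction n using Nat.strong_induction_on with
  | _ n ih =>
    rcases n with _ | n
    · exact h0
    · have h1 := congrArg (PowerSeries.coeff n) hF
      have h2 := congrArg (PowerSeries.coeff n) hG
      rw [PowerSeries.coeff_derivative, map_neg, timeSeries, PowerSeries.coeff_mk] at h1 h2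
      apply natCast_succ_mul_cancel (n := n)
      rw [mul_comm, mul_comm _ (PowerSeries.coeff (n + 1) G), Nat.cast_succ, h1, h2]
      congr 1
      refine Finset.sum_congr rfl fun p hp => ?_
      have := mem_antidiagonal.mp hp
      rw [ih p.2 (by omega)]

/-- The shift `f ↦ f(t - [λ])` is multiplicative. -/
theorem schurShift_mul (n : ℕ) (f g : A) : schurShift n (f * g)
    = ∑ p ∈ antidiagonal n, schurShift p.1 f * schurShift p.2 g := by
  have h : miwaSeries (f * g) = miwaSeries f * miwaSeries g := by
    refine powerSeries_ext_of_derivative (derivative_miwaSeries _) ?_ ?_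
    · rw [Derivation.leibniz, derivative_miwaSeries, derivative_miwaSeries, timeSeries_mul,
        smul_eq_mul, smul_eq_mul]
      ring
    · rw [PowerSeries.coeff_mul]
      simp [miwaSeries, schurShift_zero]
  have := congrArg (PowerSeries.coeff n) h
  rw [PowerSeries.coeff_mul] at this
  simpa only [miwaSeries, PowerSeries.coeff_mk] using this

end Schur

/-! ### Dressing operators and tau-functions -/

section Tau

/-- `p_n(-[∂])` applied to all coefficients of an operator. -/
def schurShiftOp (n : ℕ) (P : PDO A) : PDO A :=
  ⟨fun j => schurShift n (P.coeff j), by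
    obtain ⟨N, hN⟩ := P.coeff_bdd
    exact ⟨N, fun j hj => by simp [hN j hj]⟩⟩

theorem coeff_schurShiftOp (n : ℕ) (P : PDO A) (j : ℤ) :
    (schurShiftOp n P).coeff j = schurShift n (P.coeff j) := rfl

theorem schurShiftOp_succ (n : ℕ) (P : PDO A) :
    fn ((n + 1 : ℕ) : A) * schurShiftOp (n + 1) P
      = -∑ p ∈ antidiagonal n, dt p.1.succPNat (schurShiftOp p.2 P) := by
  ext j
  rw [coeff_fn_mul, coeff_neg, coeff_sum, coeff_schurShiftOp, schurShift_succ]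
  rfl

/-- `p_n(-[∇])P` for `∇_k P = ∂_k P + P D^k`: the coefficients of
`exp(-∑ (λ^j / j) ∇_j) P = P(t - [λ]) (1 - λ D)`. -/
def dressedShift (P : PDO A) : ℕ → PDO A
  | 0 => P
  | n + 1 => schurShiftOp (n + 1) P - schurShiftOp n P * D 1

theorem schurShiftOp_zero (P : PDO A) : schurShiftOp 0 P = P := by
  ext j
  rw [coeff_schurShiftOp, schurShift_zero]

/-- A telescoping sum: (1 - λD) ∑_a λ^a D^(a+1) = D. -/
theorem sum_dressedShift_mul_D (P : PDO A) (n : ℕ) :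
    ∑ p ∈ antidiagonal n, dressedShift P p.2 * D ((p.1 + 1 : ℕ) : ℤ)
      = schurShiftOp n P * D 1 := by
  induction n with
  | zero => simp [dressedShift, schurShiftOp_zero]
  | succ n ih =>
    rw [Finset.Nat.sum_antidiagonal_succ]
    have h : ∀ p ∈ antidiagonal n, dressedShift P p.2 * D ((p.1 + 1 + 1 : ℕ) : ℤ)
        = dressedShift P p.2 * D ((p.1 + 1 : ℕ) : ℤ) * D 1 := fun p _ => by
      rw [mul_assoc, D_mul_D, ← Nat.cast_succ]
    rw [Finset.sum_congr rfl h, ← Finset.sum_mul, ih]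
    simp only [dressedShift, zero_add, Nat.cast_one]
    noncomm_ring

/-- On P(t - [λ]) (1 - λD) the operator ∑_a λ^a ∂_{a+1} acts as -d/dλ on the first factor and leaves
the second one alone. -/
theorem sum_dt_dressedShift (P : PDO A) (n : ℕ) :
    ∑ p ∈ antidiagonal n, dt p.1.succPNat (dressedShift P p.2)
      = -(fn ((n + 1 : ℕ) : A) * schurShiftOp (n + 1) P)
        + fn (n : A) * schurShiftOp n P * D 1 := by
  rw [schurShiftOp_succ, neg_neg]
  rcases n with _ | n
  · simp [dressedShift, schurShiftOp_zero, fn_zero]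
  · rw [schurShiftOp_succ, Finset.Nat.sum_antidiagonal_succ', Finset.Nat.sum_antidiagonal_succ',
      neg_mul, Finset.sum_mul]
    simp only [dressedShift, schurShiftOp_zero, dt_sub, dt_mul, dt_D, mul_zero, add_zero,
      Finset.sum_sub_distrib]
    abel

/-- The recursion of `schurShift_succ` with ∂_k replaced by ∇_k. The parallel recursions are what
the induction in `exists_shift_operator` uses. -/
theorem dressedShift_succ (P : PDO A) (n : ℕ) :
    fn ((n + 1 : ℕ) : A) * dressedShift P (n + 1)
      = -∑ p ∈ antidiagonal n, (dt p.1.succPNat (dressedShift P p.2)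
        + dressedShift P p.2 * D ((p.1 + 1 : ℕ) : ℤ)) := by
  rw [Finset.sum_add_distrib, sum_dt_dressedShift, sum_dressedShift_mul_D, dressedShift, mul_sub]
  push_cast
  rw [fn_add, fn_one]
  noncomm_ring

variable {Q W : PDO A}

theorem pow_mul_dressing (hQ : Q * W = W * D 1) (n : ℕ) : Q ^ n * W = W * D (n : ℤ) := by
  induction n with
  | zero => rw [npow_zero_eq, one_mul, Nat.cast_zero, D_zero, mul_one]
  | succ n ih => rw [npow_succ_eq, mul_assoc, hQ, ← mul_assoc, ih, mul_assoc, D_mul_D,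
      ← Nat.cast_succ]

/-- The shift acts on the wave function and on eigenfunctions by the same differential
operators. -/
theorem exists_shift_operator (hQ : Q * W = W * D 1)
    (hW : ∀ k : ℕ+, dt k W = -(minus (Q ^ (k : ℕ)) * W)) (n : ℕ) :
    ∃ P, IsDiff P ∧ dressedShift W n = P * W ∧
      ∀ f, IsEigenfunction Q f → schurShift n f = plusAct P f := by
  induction n using Nat.strong_induction_on with
  | _ n ih =>
    rcases n with _ | n
    · exact ⟨1, isDiff_fn 1, (one_mul W).symm, fun f _ => by rw [schurShift_zero, plusAct_one]⟩
    · choose! P hP hPW hPf using ih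
      set q := algebraMap ℚ A (1 / ((n + 1 : ℕ) : ℚ)) with hq
      have hq1 : q * ((n + 1 : ℕ) : A) = 1 := by
        rw [hq, ← map_natCast (algebraMap ℚ A), ← map_mul, one_div_mul_cancel (by positivity),
          map_one]
      have hdiff : IsDiff (∑ p ∈ antidiagonal n, (dt p.1.succPNat (P p.2)
          + P p.2 * plus (Q ^ (p.1.succPNat : ℕ)))) := IsDiff.sum fun p hp => by
        have hp' := mem_antidiagonal.mp hp
        have := hP p.2 (by omega)
        exact (this.dt _).add (this.mul (isDiff_plus _))
      refine ⟨fn q * -∑ p ∈ antidiagonal n, (dt p.1.succPNat (P p.2)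
        + P p.2 * plus (Q ^ (p.1.succPNat : ℕ))), (isDiff_fn q).mul hdiff.neg, ?_, fun f hf => ?_⟩
      · have h1 : dressedShift W (n + 1)
            = fn q * (fn ((n + 1 : ℕ) : A) * dressedShift W (n + 1)) := by
          rw [← mul_assoc, ← fn_mul, hq1, fn_one, one_mul]
        rw [h1, dressedShift_succ, mul_assoc, neg_mul, Finset.sum_mul]
        congr 2
        refine Finset.sum_congr rfl fun p hp => ?_
        have hp' := mem_antidiagonal.mp hp
        have hWD := pow_mul_dressing hQ (p.1.succPNat : ℕ)
        rw [← plus_add_minus (Q ^ (p.1.succPNat : ℕ)), add_mul] at hWD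
        -- The Wilson–Sato equation as ∇_k W = L^{k/r}₊ W, parallel to ∂_k f = L^{k/r}₊(f). Both
        -- recursions therefore send P to ∂_k P + P L^{k/r}₊.
        have hWD' : plus (Q ^ (p.1.succPNat : ℕ)) * W
            = dt p.1.succPNat W + W * D ((p.1 + 1 : ℕ) : ℤ) := by
          rw [hW, show ((p.1 + 1 : ℕ) : ℤ) = ((p.1.succPNat : ℕ) : ℤ) from rfl, ← hWD]
          abel
        rw [hPW p.2 (by omega), dt_mul, add_mul, mul_assoc (P p.2) (plus _), hWD', mul_add,
          mul_assoc]
        abel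
      · rw [plusAct_fn_mul _ hdiff.neg, plusAct_neg, plusAct_sum]
        apply natCast_succ_mul_cancel (n := n)
        rw [schurShift_succ, ← mul_assoc, mul_comm _ q, hq1, one_mul]
        congr 1
        refine Finset.sum_congr rfl fun p hp => ?_
        have hp' := mem_antidiagonal.mp hp
        rw [hPf p.2 (by omega) f hf, d_plusAct _ (hP p.2 (by omega)), plusAct_add,
          plusAct_mul (hP p.2 (by omega)) (isDiff_plus _), isEigenfunction_iff.mp hf]

/-- In P = P W - P (W - 1) the last term has order below that of P, so any excess over a decreases
by one at each pass. -/
theorem ordLE_of_mul {P : PDO A} (hW : OrdLE (W - 1) (-1)) {a : ℤ} (h : OrdLE (P * W) a) :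
    OrdLE P a := by
  obtain ⟨N, hN⟩ := P.exists_ordLE
  have key : ∀ k : ℕ, OrdLE P (a + k) → OrdLE P a := by
    intro k
    induction k with
    | zero => simp
    | succ k ih =>
      intro hk
      apply ih
      have h1 : P = P * W - P * (W - 1) := by noncomm_ring
      rw [h1]
      exact (h.mono (by omega)).sub ((hk.mul hW).mono (by push_cast; omega))
  exact key (N - a).toNat (hN.mono (by omega))

/-- `f(t - [λ]) = f - λ ∂f - λ (w₁(t - [λ]) - w₁) f` for an eigenfunction `f`, where `w₁` is the
first coefficient of the dressing operator. -/
theorem IsEigenfunction.schurShift_eq (hQ : Q * W = W * D 1)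
    (hW : ∀ k : ℕ+, dt k W = -(minus (Q ^ (k : ℕ)) * W)) (hW0 : OrdLE (W - 1) (-1))
    {f : A} (hf : IsEigenfunction Q f) (n : ℕ) :
    schurShift (n + 2) f = -schurShift (n + 1) (W.coeff (-1)) * f := by
  obtain ⟨P, hP, hPW, hPf⟩ := exists_shift_operator hQ hW (n + 2)
  have hWc : ∀ j : ℤ, -1 < j → W.coeff j = if j = 0 then 1 else 0 := fun j hj =>
    coeff_of_ordLE_sub_D (n := 0) hW0 hj
  have hs : ∀ n, OrdLE (schurShiftOp (n + 1) W) (-1) := fun n j hj => by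
    rw [coeff_schurShiftOp, hWc j hj]
    split_ifs
    · exact schurShift_succ_one n
    · exact map_zero _
  -- Both shifts involved have positive index and so annihilate the leading coefficient 1 of W.
  -- Hence P is multiplication by a function.
  have hord : OrdLE (P * W) 0 := by
    rw [← hPW, dressedShift]
    exact ((hs (n + 1)).mono (by omega)).sub (((hs n).mul (ordLE_D 1)).mono (by omega))
  have hPfn := eq_fn_of_isDiff hP (ordLE_of_mul hW0 hord)
  have h0 : P.coeff 0 = -schurShift (n + 1) (W.coeff (-1)) := by
    have := congrArg (fun X => coeff X 0) hPW
    rw [hPfn] at this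
    simp only [coeff_fn_mul, hWc 0 (by omega), if_true, mul_one] at this
    rw [← this, dressedShift, coeff_sub, coeff_mul_D, hs (n + 1) 0 (by omega), coeff_schurShiftOp]
    simp
  rw [hPf f hf, hPfn, plusAct_fn, h0]

/-- The new dressing operator is T W D⁻¹: the factor D⁻¹ restores leading term 1 and commutes with
D. What remains is to match its coefficients with the shifts of φ τ. -/
theorem IsTau.darboux {φ τ : A} (hφ : IsUnit φ) (hφe : IsEigenfunction Q φ) (h : IsTau Q τ) :
    IsTau (dbOp φ * Q * dbOpInv φ) (φ * τ) := by
  obtain ⟨hτ, W, hW0, hWτ, hQ, hW⟩ := h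
  have hWcoeff0 : W.coeff 0 = 1 := by
    have := hWτ 0
    rw [schurShift_zero, Nat.cast_zero, neg_zero] at this
    exact hτ.mul_left_cancel (by rw [this, mul_one])
  have hW1 : OrdLE (W - 1) (-1) := fun j hj => by
    rw [coeff_sub, ← D_zero, coeff_D]
    rcases eq_or_ne j 0 with rfl | hj0
    · simp [hWcoeff0]
    · rw [hW0 j (by omega), if_neg hj0, sub_zero]
  have hcoeff : ∀ j : ℤ, (dbOp φ * W * D (-1)).coeff j
      = W.coeff j + dx (W.coeff (j + 1)) + dbAct φ 1 * W.coeff (j + 1) := fun j => by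
    rw [coeff_mul_D, dbOp_eq hφ, add_mul, coeff_add, coeff_D_one_mul, coeff_fn_mul]
    simp
  refine ⟨hφ.mul hτ, dbOp φ * W * D (-1), fun j hj => ?_, fun n => ?_, ?_, fun k => ?_⟩
  · rw [hcoeff, hW0 j hj, hW0 (j + 1) (by omega)]
    simp
  · rw [hcoeff]
    rcases n with _ | n
    · rw [Nat.cast_zero, neg_zero, zero_add, hWcoeff0, hW0 1 one_pos, schurShift_zero]
      simp
    · have ha : φ * dbAct φ 1 = -dx φ := by
        have h1 := congrArg (dx (A := A)) (Ring.mul_inverse_cancel φ hφ)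
        rw [Derivation.leibniz, Derivation.map_one_eq_zero, smul_eq_mul, smul_eq_mul] at h1
        rw [dbAct, mul_one]
        linear_combination φ * h1 - dx φ * Ring.mul_inverse_cancel φ hφ
      rw [show -((n + 1 : ℕ) : ℤ) + 1 = -(n : ℤ) by push_cast; ring]
      have hx := hWτ n
      have hx' := hWτ (n + 1)
      have hw : τ * W.coeff (-1) = -dx τ := by
        have := hWτ 1
        rwa [schurShift_one, Nat.cast_one] at this
      have hdx := congrArg (dx (A := A)) hx
      rw [Derivation.leibniz, smul_eq_mul, smul_eq_mul] at hdx
      set x := W.coeff (-(n : ℤ))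
      set w := W.coeff (-1)
      -- The formula for higher shifts of φ fails at i = 0, where the shift is -∂φ instead of -w φ;
      -- the extra term corrects this.
      have hφs : ∀ i, schurShift (i + 1) φ
          = -schurShift i w * φ + if i = 0 then w * φ - dx φ else 0 := fun i => by
        rcases i with _ | i
        · rw [schurShift_one, schurShift_zero, if_pos rfl]
          ring
        · rw [hφe.schurShift_eq hQ hW hW1, if_neg (by omega), add_zero]
      have hsum : schurShift (n + 1) (φ * τ) = φ * schurShift (n + 1) τ
          + φ * dx (schurShift n τ) + (w * φ - dx φ) * schurShift n τ := by
        rw [schurShift_mul, Finset.Nat.sum_antidiagonal_succ, schurShift_zero]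
        simp only [hφs, add_mul, Finset.sum_add_distrib]
        -- The convolution is the shift of w τ = -∂τ.
        have e1 : ∑ p ∈ antidiagonal n, -schurShift p.1 w * φ * schurShift p.2 τ
            = φ * dx (schurShift n τ) := by
          have := schurShift_mul n w τ
          rw [mul_comm w, hw, map_neg, schurShift_dx] at this
          have e3 : ∑ p ∈ antidiagonal n,
              -schurShift p.1 w * φ * schurShift p.2 τ = -φ *
              ∑ p ∈ antidiagonal n, schurShift p.1 w * schurShift p.2 τ := by
            rw [Finset.mul_sum]
            exact Finset.sum_congr rfl fun p _ => by ring
          rw [e3, ← this]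
          ring
        have e2 : ∑ p ∈ antidiagonal n,
            (if p.1 = 0 then w * φ - dx φ else 0) * schurShift p.2 τ
            = (w * φ - dx φ) * schurShift n τ := by
          rw [Finset.sum_eq_single (0, n)]
          · simp
          · rintro ⟨i, j⟩ hp hne
            have := mem_antidiagonal.mp hp
            have hi : i ≠ 0 := by
              rintro rfl
              exact hne (by simpa using this)
            simp [hi]
          · intro hne
            exact absurd (mem_antidiagonal.mpr (zero_add n)) hne
        rw [e1, e2]
        ring
      rw [hsum]
      linear_combination φ * hx' + φ * hdx + (φ * w - dx φ) * hx + τ * x * ha - φ * x * hw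
  · rw [← mul_assoc, ← mul_assoc, mul_assoc _ (dbOpInv φ), inv_mul_dbOp hφ, mul_one,
      mul_assoc (dbOp φ), hQ, mul_assoc _ (D (-1)), D_inv_mul_D, ← mul_assoc, mul_assoc _ (D 1),
      D_mul_D_inv]
  · have hB := plus_conj_pow_mul hφ hφe k
    have hpow := dbOp_conj_pow hφ Q (k : ℕ)
    have hM : minus ((dbOp φ * Q * dbOpInv φ) ^ (k : ℕ)) * dbOp φ
        = dbOp φ * minus (Q ^ (k : ℕ)) - dt k (dbOp φ) := by
      have e1 := plus_add_minus ((dbOp φ * Q * dbOpInv φ) ^ (k : ℕ))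
      have e2 := plus_add_minus (Q ^ (k : ℕ))
      rw [eq_sub_of_add_eq' e1, sub_mul, hB, hpow, conj_mul_dbOp hφ, eq_sub_of_add_eq' e2]
      noncomm_ring
    rw [dt_mul, dt_mul, dt_D, mul_zero, add_zero, hW, ← mul_assoc, ← mul_assoc, hM]
    noncomm_ring

end Tau

end

noncomputable section

open PDO

variable {A : Type*} [CommRing A] [Algebra ℚ A] [TimeAlgebra A]

/-! ### Wronskian formulas -/

section Wronskian

/-- Adding to the last row of a Wronskian a combination of the other rows that annihilates all but
the last function. -/
theorem wronskian_snoc {n : ℕ} (f : Fin n → A) (g : A) (c : Fin (n + 1) → A)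
    (hc : c (Fin.last n) = 1) (h0 : ∀ j, ∑ i, c i * (dx (A := A))^[(i : ℕ)] (f j) = 0) :
    wronskian (Fin.snoc (α := fun _ => A) f g)
      = wronskian f * ∑ i, c i * (dx (A := A))^[(i : ℕ)] g := by
  set M : Matrix (Fin (n + 1)) (Fin (n + 1)) A := Matrix.of fun i j =>
    (dx (A := A))^[(i : ℕ)] (Fin.snoc (α := fun _ => A) f g j) with hM
  have h1 := Matrix.det_updateRow_sum M (Fin.last n) c
  rw [hc, one_smul] at h1
  change M.det = _
  have hrow : ∀ j, (∑ k, c k • M k) j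
      = ∑ i, c i * (dx (A := A))^[(i : ℕ)] (Fin.snoc (α := fun _ => A) f g j) := fun j => by
    simp [hM, Finset.sum_apply]
  rw [← h1, Matrix.det_succ_row _ (Fin.last n), Fin.sum_univ_castSucc, Finset.sum_eq_zero, zero_add]
  · rw [Matrix.updateRow_self, hrow, Fin.snoc_last, Fin.val_last, ← two_mul, pow_mul, neg_one_sq,
      one_pow, one_mul, mul_comm]
    congr 1
    rw [wronskian]
    congr 1
    ext i j
    simp [hM, Matrix.updateRow_ne, (Fin.castSucc_lt_last i).ne]
  · intro j _
    rw [Matrix.updateRow_self, hrow, Fin.snoc_castSucc, h0, mul_zero, zero_mul]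

variable {m : ℕ} [NeZero m] {χ : ℕ → Fin m → A}

/-- The `n`-th function in the list `χ_1^{(0)}, …, χ_m^{(0)}, χ_1^{(1)}, …`. -/
def chiEntry (χ : ℕ → Fin m → A) (n : ℕ) : A := χ (n / m) (stepIdx m n)

theorem chiList_succ {A : Type*} (χ : ℕ → Fin m → A) (n : ℕ) :
    chiList χ (n + 1) = Fin.snoc (α := fun _ => A) (chiList χ n) (chiEntry χ n) := by
  funext j
  induction j using Fin.lastCases with
  | last => rw [Fin.snoc_last]; rfl
  | cast j => rw [Fin.snoc_castSucc]; rfl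

theorem stepIdx_eq_iff (j : ℕ) (i : Fin m) : stepIdx m j = i ↔ j ≡ i [MOD m] := by
  rw [stepIdx, Fin.ext_iff, Nat.ModEq, Nat.mod_eq_of_lt i.isLt]
  rfl

/-- Each step made with index i raises the power of L^{(0)} on the i-th function by one, so the
exponent counts those steps. -/
theorem orbitFn_eq_orbitChain (χ : ℕ → Fin m → A) (n s : ℕ) (i : Fin m) :
    orbitFn χ n s i = orbitChain χ n (χ (s + Nat.count (· ≡ (i : ℕ) [MOD m]) n) i) := by
  induction n generalizing s with
  | zero => simp [orbitFn, orbitChain]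
  | succ n ih =>
    rw [orbitFn_succ, ih, Nat.count_succ, orbitChain]
    simp only [eq_comm (a := i), stepIdx_eq_iff]
    congr 3
    split_ifs <;> omega

theorem orbitEigen_eq (χ : ℕ → Fin m → A) {k l : ℕ} (hlm : l ≤ m) (i : Fin m) :
    orbitEigen χ (k * m + l) i = orbitChain χ (k * m + l) (chiPM χ k l i) := by
  have hm : 0 < m := Nat.pos_of_ne_zero (NeZero.ne m)
  rw [orbitEigen, orbitFn_eq_orbitChain, Nat.count_modEq_card _ hm, zero_add,
    Nat.mod_eq_of_lt i.isLt, chiPM]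
  congr 1
  -- For l = m the remainder of km + l modulo m is 0 and the quotient is k + 1, so this case is
  -- separate.
  rcases hlm.eq_or_lt with rfl | h
  · rw [if_pos i.isLt, ← Nat.succ_mul, Nat.mul_mod_left, Nat.mul_div_cancel _ hm,
      if_neg (Nat.not_lt_zero _), add_zero]
  · rw [Nat.add_comm (k * m), Nat.add_mul_mod_self_right, Nat.mod_eq_of_lt h,
      Nat.add_mul_div_right _ _ hm, Nat.div_eq_of_lt h, zero_add]
    split_ifs <;> rfl

theorem stepFn_eq (χ : ℕ → Fin m → A) (n : ℕ) :
    stepFn χ n = orbitChain χ n (chiEntry χ n) := by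
  have hm : 0 < m := Nat.pos_of_ne_zero (NeZero.ne m)
  have h : ((stepIdx m n : Fin m) : ℕ) = n % m := rfl
  rw [stepFn, orbitEigen, orbitFn_eq_orbitChain, Nat.count_modEq_card _ hm, h, Nat.mod_mod,
    if_neg (lt_irrefl _), add_zero, zero_add, chiEntry]

/-- The first j transformations carry entry j to the very function with which step j is made. That
step annihilates it, and later ones preserve zero. -/
theorem orbitChain_chiEntry {n j : ℕ} (hj : j < n) (hunit : ∀ i < n, IsUnit (stepFn χ i)) :
    orbitChain χ n (chiEntry χ j) = 0 := by
  induction n, hj using Nat.le_induction with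
  | base => rw [orbitChain, ← stepFn_eq, dbAct_self (hunit j (Nat.lt_succ_self j))]
  | succ n hjn ih =>
    rw [orbitChain, ih fun i hi => hunit i (by omega), dbAct, mul_zero, map_zero, mul_zero]

/-- `T^{(n-1)} ⋯ T^{(0)}` is a monic differential operator of order `n`. -/
theorem exists_orbitChain_operator {n : ℕ} (hunit : ∀ i < n, IsUnit (stepFn χ i)) :
    ∃ P : PDO A, IsDiff P ∧ OrdLE (P - D (n : ℤ)) (n - 1) ∧
      ∀ g, orbitChain χ n g = plusAct P g := by
  induction n with
  | zero =>
    refine ⟨1, isDiff_fn 1, ?_, fun g => (plusAct_one g).symm⟩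
    rw [Nat.cast_zero, D_zero, sub_self]
    exact fun _ _ => rfl
  | succ n ih =>
    obtain ⟨P, hP, hPn, hact⟩ := ih fun i hi => hunit i (by omega)
    have hφ := hunit n (Nat.lt_succ_self n)
    refine ⟨dbOp (stepFn χ n) * P, (isDiff_dbOp _).mul hP, ?_, fun g => ?_⟩
    · have h : dbOp (stepFn χ n) * P - D ((n + 1 : ℕ) : ℤ)
          = dbOp (stepFn χ n) * (P - D (n : ℤ)) + fn (dbAct (stepFn χ n) 1) * D (n : ℤ) := by
        rw [Nat.cast_succ, add_comm, ← D_mul_D, dbOp_eq hφ]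
        noncomm_ring
      rw [h]
      refine (((ordLE_dbOp _).mul hPn).mono ?_).add (((ordLE_fn _).mul (ordLE_D _)).mono ?_) <;>
        push_cast <;> omega
    · rw [orbitChain, hact, dbAct_eq_plusAct, plusAct_mul (isDiff_dbOp _) hP]

/-- The Wronskian form of iterated Darboux transformations. -/
theorem wronskian_snoc_chiList {n : ℕ} (hunit : ∀ i < n, IsUnit (stepFn χ i)) (g : A) :
    wronskian (Fin.snoc (α := fun _ => A) (chiList χ n) g)
      = wronskian (chiList χ n) * orbitChain χ n g := by
  obtain ⟨P, hP, hPn, hact⟩ := exists_orbitChain_operator hunit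
  have hsum : ∀ f, ∑ i : Fin (n + 1), P.coeff (i : ℕ) * (dx (A := A))^[(i : ℕ)] f
      = orbitChain χ n f := fun f => by
    rw [hact, plusAct, Fin.sum_univ_eq_sum_range fun i : ℕ => P.coeff i * (dx (A := A))^[i] f,
      finsum_eq_sum_of_support_subset]
    intro k hk
    simp only [Finset.coe_range, Set.mem_Iio]
    by_contra h
    refine hk ?_
    simp only
    rw [coeff_of_ordLE_sub_D hPn (by omega), if_neg (by omega), zero_mul]
  rw [wronskian_snoc _ g (fun i => P.coeff (i : ℕ)), hsum]
  · rw [Fin.val_last, coeff_of_ordLE_sub_D hPn (by omega), if_pos rfl]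
  · exact fun j => (hsum _).trans (orbitChain_chiEntry j.isLt hunit)

/-- Multiplication by the n-th step function, the chain applied to the next entry of the list, turns
one Wronskian into the next. -/
theorem prod_stepFn {n : ℕ} (hunit : ∀ i < n, IsUnit (stepFn χ i)) :
    ∏ i ∈ Finset.range n, stepFn χ i = wronskian (chiList χ n) := by
  induction n with
  | zero => simp [wronskian]
  | succ n ih =>
    have hn : ∀ i < n, IsUnit (stepFn χ i) := fun i hi => hunit i (by omega)
    rw [Finset.prod_range_succ, ih hn, chiList_succ, wronskian_snoc_chiList hn, stepFn_eq]

end Wronskian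

end

/-! ### The Darboux–Bäcklund orbit -/

theorem proposition3p5 {A : Type*} [CommRing A] [Algebra ℚ A] [TimeAlgebra A]
    (r m : ℕ) (hr : 1 ≤ r) [NeZero m]
    -- the initial Lax operator, with its `r`-th root and its (adjoint) eigenfunctions
    (L Q : PDO A) (Φ Ψ : Fin m → A) (h0 : IsCKP r L Q Φ Ψ)
    -- `χ s i = L^s (Φ_i)`
    (χ : ℕ → Fin m → A) (hχ0 : χ 0 = Φ)
    (hχ : ∀ s i, ∃ S, IsActionWith L Q Φ Ψ S (χ s i) (χ (s + 1) i))
    (k l : ℕ) (hl : 1 ≤ l) (hlm : l ≤ m)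
    -- the first `km + l` transformations `T = φ D φ⁻¹` exist
    (hunit : ∀ n < k * m + l, IsUnit (stepFn χ n)) :
    -- all elements of the orbit are Lax operators of `cKP_{r,m}`
    (∃ Θ : ℕ → Fin m → A, Θ 0 = Ψ ∧
      (∀ n ≤ k * m + l,
        IsCKP r (orbitOp χ L n) (orbitOp χ Q n) (orbitEigen χ n) (Θ n)) ∧
      -- each step transforms the (adjoint) eigenfunctions as it should
      ∀ n < k * m + l, ∃ S : Fin m → A, ∃ g : A,
        IsActionWith (orbitOp χ L n) (orbitOp χ Q n) (orbitEigen χ n) (Θ n) S (stepFn χ n) g ∧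
        orbitEigen χ (n + 1) (stepIdx m n) = dbAct (stepFn χ n) g ∧
        Θ (n + 1) (stepIdx m n) = Ring.inverse (stepFn χ n) ∧
        ∀ i, i ≠ stepIdx m n →
          orbitEigen χ (n + 1) i = dbAct (stepFn χ n) (orbitEigen χ n i) ∧
          Θ (n + 1) i = -(Ring.inverse (stepFn χ n) * S i)) ∧
    -- the eigenfunctions
    IsUnit (wronskian (chiList χ (k * m + l))) ∧
    (∀ i, orbitEigen χ (k * m + l) i = orbitChain χ (k * m + l) (chiPM χ k l i) ∧
      orbitEigen χ (k * m + l) i =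
        wronskian (Fin.snoc (α := fun _ => A) (chiList χ (k * m + l)) (chiPM χ k l i)) *
          Ring.inverse (wronskian (chiList χ (k * m + l)))) ∧
    -- the tau-functions
    (∏ n ∈ Finset.range (k * m + l), stepFn χ n = wronskian (chiList χ (k * m + l))) ∧
    ∀ τ : A, IsTau Q τ →
      IsTau (orbitOp χ Q (k * m + l)) (wronskian (chiList χ (k * m + l)) * τ) := by
  obtain ⟨Θ, hΘ0, hΘ, hstep⟩ := exists_orbit_adjoint h0 hχ0 hχ (k * m + l) hunit
  have hprod := prod_stepFn hunit
  have hW : IsUnit (wronskian (chiList χ (k * m + l))) := by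
    rw [← hprod]
    exact IsUnit.prod_iff.mpr fun n hn => hunit n (Finset.mem_range.mp hn)
  refine ⟨⟨Θ, hΘ0, fun n hn => (hΘ n hn).1, fun n hn => ?_⟩, hW, fun i => ?_, hprod,
    fun τ hτ => ?_⟩
  · obtain ⟨S, hS, hΘS⟩ := hstep n hn
    refine ⟨S, _, hS, ?_, ?_, fun i hi => ⟨?_, ?_⟩⟩
    · rw [orbitEigen, orbitFn_succ, if_pos rfl]
    · rw [hΘS, darbouxAdjoint, if_pos rfl]
      rfl
    · rw [orbitEigen, orbitFn_succ, if_neg hi]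
      rfl
    · rw [hΘS, darbouxAdjoint, if_neg hi]
      rfl
  · have h := orbitEigen_eq χ hlm (k := k) i
    refine ⟨h, ?_⟩
    rw [wronskian_snoc_chiList hunit, h, mul_right_comm, Ring.mul_inverse_cancel _ hW, one_mul]
  · rw [← hprod]
    have key : ∀ n ≤ k * m + l,
        IsTau (orbitOp χ Q n) ((∏ i ∈ Finset.range n, stepFn χ i) * τ) := by
      intro n
      induction n with
      | zero => intro _; simpa [orbitOp] using hτ
      | succ n ih =>
        intro hn
        have := (ih (by omega)).darboux (hunit n (by omega))
          ((hΘ n (by omega)).1.eigen (stepIdx m n))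
        rwa [← mul_assoc, mul_comm (stepFn χ n), ← Finset.prod_range_succ] at this
    exact key _ le_rfl
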